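/- Let $G$ be a finite group. A $G$-lattice is a free abelian group $L$ of finite rank with a linear action of $G$; a class $\alpha\in H^2(G,L)$ is special if its restriction to every nontrivial subgroup of $G$ is nonzero. Let $n(G)$ (the Vasquez number) be the smallest natural number $n$ such that for every faithful $G$-lattice $L$ and every special $\alpha\in H^2(G,L)$ there is a $G$-submodule $N\subseteq L$ with $L/N$ torsion-free of rank at most $n$ such that the image of $\alpha$ in $H^2(G,L/N)$ is special. An aspherical Kähler group of (complex) dimension $d$ is the fundamental group $\Gamma$ of a quotient of a compact complex $d$-torus by a free action of a finite group; equivalently, $\Gamma$ is isomorphic to a subgroup of $U(d)\ltimes\mathbb C^d$ that acts freely on $\mathbb C^d$, whose translations form a lattice $L$ of rank $2d$ in $\mathbb C^d$, and whose image in $U(d)$, the holonomy group $\Gamma/L$, is finite. Let $n_{\mathbb C}(G)$ (the complex Vasquez number) be the smallest natural number $m$ such that every aspherical Kähler group $\Gamma$ with holonomy group isomorphic to $G$ has a normal subgroup $M\subseteq L$, where $L$ is its translation lattice, such that $\Gamma/M$ is an aspherical Kähler group of dimension at most $m$. Let $\mathrm{Irr}(G)$ be the set of complex irreducible characters of $G$,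 let $\nu_2(\chi)=\frac1{|G|}\sum_{g\in G}\chi(g^2)$, let $\mathrm{Irr}_1(G)=\{\chi\in\mathrm{Irr}(G):\nu_2(\chi)=1\}$, and let the Schur index $m_{\mathbb Q}(\chi)$ be the multiplicity of $\chi$ in the character of an irreducible $\mathbb QG$-module in which it occurs. Proposition. For every finite group $G$ the numbers $n(G)$ and $n_{\mathbb C}(G)$ exist, and 1. $n(G)/2\le n_{\mathbb C}(G)$; 2. $n_{\mathbb C}(G)\le n(G)$; 3. $\displaystyle n_{\mathbb C}(G)\le\frac12\Bigl(n(G)+\sum_{\chi\in\mathrm{Irr}_1(G)}m_{\mathbb Q}(\chi)\,\chi(1)\Bigr)$. -/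

import Mathlib

open CategoryTheory

noncomputable section

/-! ### The Vasquez number of a finite group -/

/-- A class in `H²(G, A)` is special if its restriction to every nontrivial subgroup of `G` is
nonzero. -/
def IsSpecialClass {G : Type} [Group G] (A : Rep.{0} ℤ G) (α : groupCohomology A 2) : Prop :=
  ∀ H : Subgroup G, H ≠ ⊥ →
    groupCohomology.map H.subtype (𝟙 (Rep.res H.subtype A)) 2 α ≠ 0

/-- `n` has the property required in Vasquez's theorem for the group `G`: whenever `L` is a
faithful `G`-lattice (a free `ℤ`-module of finite rank on which `G` acts faithfully) with a special
class `α ∈ H²(G, L)`, there is a `G`-stable pure submodule `N` of `L` (that is, `L / N` is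
torsion-free) such that `L / N` has rank at most `n` and the image of `α` in `H²(G, L / N)` is
special.

`G` lives in an arbitrary universe and `Q` runs through the copies of `G` in `Type`, where
Mathlib provides `H²` with integral coefficients. -/
def IsVasquezBound (G : Type*) [Group G] (n : ℕ) : Prop :=
  ∀ (Q : Type) [Group Q], Nonempty (Q ≃* G) →
    ∀ (L : Type) [AddCommGroup L] [Module.Free ℤ L] [Module.Finite ℤ L]
      (ρ : Representation ℤ Q L), Function.Injective ρ →
      ∀ α : groupCohomology (Rep.of ρ) 2, IsSpecialClass (Rep.of ρ) α →
        ∃ (N : Submodule ℤ L) (hN : ∀ g : Q, N ≤ N.comap (ρ g)),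
          Module.IsTorsionFree ℤ (L ⧸ N) ∧ Module.finrank ℤ (L ⧸ N) ≤ n ∧
            IsSpecialClass ((Rep.of ρ).quotient N hN)
              ((groupCohomology.functor ℤ Q 2).map ((Rep.of ρ).mkQ N hN) α)

/-- The Vasquez number `n(G)`. -/
def vasquezNumber (G : Type*) [Group G] : ℕ :=
  sInf {n : ℕ | IsVasquezBound G n}

/-! ### Fundamental groups of compact flat Kähler manifolds -/

/-- The group `U(n) ⋉ ℂⁿ` of complex affine isometries of `ℂⁿ`. -/
abbrev UnitaryAffineGroup (n : ℕ) : Type :=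
  EuclideanSpace ℂ (Fin n) ≃ᵃⁱ[ℂ] EuclideanSpace ℂ (Fin n)

/-- The projection `U(n) ⋉ ℂⁿ → U(n)`. -/
def linearPart (n : ℕ) :
    UnitaryAffineGroup n →* (EuclideanSpace ℂ (Fin n) ≃ₗᵢ[ℂ] EuclideanSpace ℂ (Fin n)) where
  toFun γ := γ.linearIsometryEquiv
  map_one' := rfl
  map_mul' _ _ := rfl

/-- The holonomy group of `Γ`: the image of `Γ` in `U(n)`. -/
def holonomyGroup {n : ℕ} (Γ : Subgroup (UnitaryAffineGroup n)) :
    Subgroup (EuclideanSpace ℂ (Fin n) ≃ₗᵢ[ℂ] EuclideanSpace ℂ (Fin n)) :=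
  Γ.map (linearPart n)

/-- The subgroup of translations in `Γ`, the kernel of `Γ` onto its holonomy group. -/
def translationSubgroup {n : ℕ} (Γ : Subgroup (UnitaryAffineGroup n)) : Subgroup Γ :=
  ((linearPart n).comp Γ.subtype).ker

/-- The vectors `v ∈ ℂⁿ` for which the translation by `v` belongs to `Γ`. -/
def translationLattice {n : ℕ} (Γ : Subgroup (UnitaryAffineGroup n)) :
    AddSubgroup (EuclideanSpace ℂ (Fin n)) where
  carrier := {v | AffineIsometryEquiv.constVAdd ℂ (EuclideanSpace ℂ (Fin n)) v ∈ Γ}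
  zero_mem' := by
    simp only [Set.mem_ofPred_eq, AffineIsometryEquiv.constVAdd_zero]
    exact Γ.one_mem
  add_mem' := by
    intro v w hv hw
    have h : AffineIsometryEquiv.constVAdd ℂ (EuclideanSpace ℂ (Fin n)) (v + w) =
        AffineIsometryEquiv.constVAdd ℂ (EuclideanSpace ℂ (Fin n)) v *
          AffineIsometryEquiv.constVAdd ℂ (EuclideanSpace ℂ (Fin n)) w := by
      ext1 x
      exact add_assoc v w x
    simp only [Set.mem_ofPred_eq] at hv hw ⊢
    rw [h]
    exact Γ.mul_mem hv hw
  neg_mem' := by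
    intro v hv
    have h : AffineIsometryEquiv.constVAdd ℂ (EuclideanSpace ℂ (Fin n)) (-v) =
        (AffineIsometryEquiv.constVAdd ℂ (EuclideanSpace ℂ (Fin n)) v)⁻¹ := by
      rw [eq_inv_iff_mul_eq_one]
      ext1 x
      exact neg_add_cancel_left v x
    simp only [Set.mem_ofPred_eq] at hv ⊢
    rw [h]
    exact Γ.inv_mem hv

/-- `ℂⁿ / Γ` is a compact flat Kähler manifold: the translations in `Γ` form a lattice `Λ` of full
rank in `ℂⁿ`, the group `Γ / Λ` is finite, and `Γ` acts freely on `ℂⁿ`. Thus `ℂⁿ / Γ` is the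
quotient of the complex torus `ℂⁿ / Λ` by a free action of the finite group `Γ / Λ`, and `Γ` is its
fundamental group. -/
structure IsFlatKahlerGroup {n : ℕ} (Γ : Subgroup (UnitaryAffineGroup n)) : Prop where
  discrete : DiscreteTopology (translationLattice Γ)
  span_eq_top :
    Submodule.span ℝ (translationLattice Γ : Set (EuclideanSpace ℂ (Fin n))) = ⊤
  finite_holonomy : Finite (holonomyGroup Γ)
  free : ∀ γ ∈ Γ, ∀ x : EuclideanSpace ℂ (Fin n), γ x = x → γ = 1

/-- The abstract group `Δ` is an aspherical Kähler group of complex dimension `d`: the fundamental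
group of a compact flat Kähler manifold of complex dimension `d`. -/
def IsAsphericalKahler (d : ℕ) (Δ : Type*) [Group Δ] : Prop :=
  ∃ Γ : Subgroup (UnitaryAffineGroup d), IsFlatKahlerGroup Γ ∧ Nonempty (Δ ≃* Γ)

/-- `m` has the property required of the complex Vasquez number of `G`: for every aspherical Kähler
group `Γ` (of any dimension) with holonomy group `G` there is a normal subgroup `M` of `Γ`,
contained in the translation lattice, such that `Γ / M` is an aspherical Kähler group of complex
dimension at most `m`. -/
def IsComplexVasquezBound (G : Type*) [Group G] (m : ℕ) : Prop :=
  ∀ (n : ℕ) (Γ : Subgroup (UnitaryAffineGroup n)), IsFlatKahlerGroup Γ →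
    Nonempty (holonomyGroup Γ ≃* G) →
      ∃ (M : Subgroup Γ) (_ : M.Normal), M ≤ translationSubgroup Γ ∧
        ∃ d ≤ m, IsAsphericalKahler d (Γ ⧸ M)

/-- The complex Vasquez number `n_ℂ(G)`. -/
def complexVasquezNumber (G : Type*) [Group G] : ℕ :=
  sInf {m : ℕ | IsComplexVasquezBound G m}

/-! ### Characters, Frobenius–Schur indicators and Schur indices -/

/-- The set `Irr(G)` of complex irreducible characters of `G`. -/
def Irr (G : Type*) [Group G] : Set (G → ℂ) :=
  {χ | ∃ (d : ℕ) (ρ : Representation ℂ G (Fin d → ℂ)), ρ.IsIrreducible ∧ ρ.character = χ}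

/-- The usual inner product of class functions. -/
def charInner {G : Type*} [Group G] [Fintype G] (φ ψ : G → ℂ) : ℂ :=
  (Fintype.card G : ℂ)⁻¹ * ∑ g : G, φ g * (starRingEnd ℂ) (ψ g)

/-- The Frobenius–Schur indicator `ν₂(χ)`. -/
def frobeniusSchur {G : Type*} [Group G] [Fintype G] (χ : G → ℂ) : ℂ :=
  (Fintype.card G : ℂ)⁻¹ * ∑ g : G, χ (g ^ 2)

/-- The Schur index `m_ℚ(χ)` of `χ ∈ Irr(G)` over the rationals: the multiplicity of `χ` in an
irreducible rational representation of `G` whose character contains `χ`. Such a representation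
exists and is unique up to isomorphism, so the set below has exactly one element. -/
def schurIndexRat {G : Type*} [Group G] [Fintype G] (χ : G → ℂ) : ℕ :=
  sInf {m : ℕ | 0 < m ∧ ∃ (d : ℕ) (ρ : Representation ℚ G (Fin d → ℚ)), ρ.IsIrreducible ∧
    charInner (fun g => ((ρ.character g : ℚ) : ℂ)) χ = m}

/-- `Irr(G)` is finite, since irreducible characters are linearly independent functions on `G`. -/
theorem irr_finite (G : Type*) [Group G] [Fintype G] : (Irr G).Finite := by
  classical
  have : Invertible (Nat.card G : ℂ) :=
    invertibleOfNonzero (Nat.cast_ne_zero.2 Nat.card_pos.ne')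
  have key : ∀ χ ∈ Irr G, ∀ ψ ∈ Irr G,
      (Nat.card G : ℂ)⁻¹ * ∑ g : G, ψ g * χ g⁻¹ = if χ = ψ then 1 else 0 := by
    rintro _ ⟨d, ρ, hρ, rfl⟩ _ ⟨e, σ, hσ, rfl⟩
    have h := Representation.char_orthonormal σ ρ
    rw [h]
    by_cases hc : ρ.character = σ.character
    · by_cases hn : Nonempty (Representation.Equiv ρ σ)
      · simp [hc, hn]
      · exfalso
        have h1 := Representation.char_orthonormal ρ ρ
        rw [if_pos ⟨Representation.Equiv.refl ρ⟩] at h1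
        rw [if_neg hn, ← hc, h1] at h
        exact one_ne_zero h
    · rw [if_neg hc, if_neg]
      rintro ⟨φ⟩
      exact hc (Representation.char_iso φ)
  let f : Irr G → Module.Dual ℂ (G → ℂ) := fun χ =>
    (Nat.card G : ℂ)⁻¹ • ∑ g : G, χ.1 g⁻¹ • LinearMap.proj g
  have hf : ∀ χ ψ : Irr G, f χ ψ.1 = if χ = ψ then 1 else 0 := by
    intro χ ψ
    have h := key χ.1 χ.2 ψ.1 ψ.2
    simp only [Subtype.coe_inj] at h
    rw [← h]
    simp [f, mul_comm]
  have hli : LinearIndependent ℂ (fun χ : Irr G => χ.1) := by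
    refine LinearIndependent.of_pairwise_dual_eq_zero_one _ f ?_ ?_
    · intro χ ψ hne
      simp [hf, hne]
    · intro χ
      simp [hf]
  have : Finite (Irr G) := hli.finite
  exact Set.toFinite _

/-- The set `Irr₁(G)` of the irreducible characters with Frobenius–Schur indicator `1`. -/
def irrReal (G : Type*) [Group G] [Fintype G] : Finset (G → ℂ) :=
  ((irr_finite G).subset (Set.sep_subset (Irr G) fun χ => frobeniusSchur χ = 1)).toFinset

end

/-!
The cohomological definition of the Vasquez number is first replaced by one about extensions: the
class of an extension `1 → L → E → Q → 1` is special if and only if `E` has no torsion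
(`LatticeExtension.isSpecialClass_iff_hasNoTorsion`). That some bound exists is Vasquez's theorem,
`isVasquezBound_card_sq`: for each `c ≠ 1` in `Q` there is a functional on `L` that vanishes on no
power `e ^ orderOf c` of a lift `e` of `c`, and the common kernel of all translates of these
functionals is the submodule sought.

Aspherical Kähler groups are the torsion-free extensions of finite groups by faithful lattices for
which `ℝ ⊗ L` has an invariant complex structure. In one direction `ℝ ⊗ L = ℂⁿ` for the translation
lattice, and a finite-order element would fix the centroid of an orbit. In the other
(`LatticeExtension.exists_isFlatKahlerGroup`) the inclusion of `L` in `ℝ ⊗ L` extends to a crossed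
homomorphism on `E` by averaging, and `E` acts by unitary affine maps; the action is free because
`E` has no torsion.

For `n(G) / 2 ≤ n_ℂ(G)`, let `E` be a torsion-free extension of `Q` by `L`. The fibre product
`E ×_Q E` is an extension by `L × L`, which has the complex structure `(x, y) ↦ (-y, x)`. It is thus
a Kähler group, and its quotient of dimension `d ≤ n_ℂ(G)` contains a torsion-free quotient of the
diagonal copy of `E`, whose lattice has rank at most `2 d`.

For the upper bounds, let `N` be the submodule of the translation lattice `L` provided by the
definition of `n(G)`. Any smaller pure submodule `M` gives a torsion-free quotient as well, so it
remains to find one for which `L / M` has a complex structure and small rank. Rationally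
`L = L / N × K`, and `K` may be replaced by a quotient `P` that is minimal such that `L / N × P` has
a complex structure over `ℝ`. A real representation has a complex structure if its irreducible
constituents without one have even multiplicity, so that summands with a complex structure cancel.
By minimality `P` is multiplicity-free, its constituents have no complex structure over `ℝ`, and
they all occur in `L / N`. Hence `dim P ≤ rank (L / N)`, which bounds the dimension by `n(G)`.
Moreover all complex constituents `χ` of `P` have indicator `ν₂(χ) = 1` and multiplicity `m_ℚ(χ)`, so
that `dim P ≤ ∑ m_ℚ(χ) χ(1)`. That a single constituent with `ν₂(χ) = 1` of an irreducible rational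
representation forces this on all of them (`Representation.frobeniusSchur_eq_one_of_common`)
follows without Galois theory, from the action of the central element `∑ g²` of the group algebra.
-/

open scoped TensorProduct

set_option linter.unusedSectionVars false

universe u

/-! ### Extensions of a group by a lattice -/

/-- An extension `1 → L → E → Q → 1` of a group `Q` by an abelian group `L`, written additively,
such that conjugation induces the given action `ρ` of `Q` on `L`. -/
structure LatticeExtension (E : Type*) {Q L : Type*} [Group E] [Group Q] [AddCommGroup L]
    (ρ : Representation ℤ Q L) where
  /-- The inclusion of the kernel, which turns sums into products. -/
  incl : L → E
  /-- The projection onto the quotient. -/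
  proj : E →* Q
  incl_add : ∀ a b, incl (a + b) = incl a * incl b
  incl_injective : Function.Injective incl
  proj_surjective : Function.Surjective proj
  proj_eq_one_iff : ∀ e, proj e = 1 ↔ ∃ l, incl l = e
  conj_incl : ∀ e l, e * incl l * e⁻¹ = incl (ρ (proj e) l)

/-- A group all of whose elements of finite order are trivial. -/
def HasNoTorsion (E : Type*) [Group E] : Prop :=
  ∀ (e : E) (k : ℕ), 0 < k → e ^ k = 1 → e = 1

theorem HasNoTorsion.of_injective {E F : Type*} [Group E] [Group F] (f : E →* F)
    (hf : Function.Injective f) (hF : HasNoTorsion F) : HasNoTorsion E := by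
  intro e k hk h
  apply hf
  rw [map_one]
  exact hF _ k hk (by rw [← map_pow, h, map_one])

namespace LatticeExtension

variable {E Q L : Type*} [Group E] [Group Q] [AddCommGroup L] {ρ : Representation ℤ Q L}
  (X : LatticeExtension E ρ)

/-- The inclusion of the kernel as a homomorphism of groups. -/
def inclHom : Multiplicative L →* E where
  toFun l := X.incl l.toAdd
  map_one' := by
    have h := X.incl_add 0 0
    rw [add_zero] at h
    exact (mul_eq_left.1 h.symm)
  map_mul' a b := X.incl_add a.toAdd b.toAdd

theorem incl_zero : X.incl 0 = 1 := X.inclHom.map_one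

theorem incl_neg (a : L) : X.incl (-a) = (X.incl a)⁻¹ :=
  X.inclHom.map_inv (Multiplicative.ofAdd a)

theorem incl_nsmul (n : ℕ) (a : L) : X.incl (n • a) = X.incl a ^ n :=
  X.inclHom.map_pow (Multiplicative.ofAdd a) n

theorem incl_eq_one_iff (a : L) : X.incl a = 1 ↔ a = 0 := by
  rw [← X.incl_zero, X.incl_injective.eq_iff]

theorem proj_incl (a : L) : X.proj (X.incl a) = 1 := (X.proj_eq_one_iff _).2 ⟨a, rfl⟩

theorem mul_incl (e : E) (l : L) : e * X.incl l = X.incl (ρ (X.proj e) l) * e := by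
  rw [← X.conj_incl, inv_mul_cancel_right]

theorem exists_incl_mul_eq {e f : E} (h : X.proj e = X.proj f) : ∃ l, X.incl l * f = e := by
  obtain ⟨l, hl⟩ := (X.proj_eq_one_iff (e * f⁻¹)).1 (by rw [map_mul, map_inv, h, mul_inv_cancel])
  exact ⟨l, by rw [hl, inv_mul_cancel_right]⟩

/-- The image in `E` of a submodule of the kernel `L`. -/
def inclSubgroup (N : Submodule ℤ L) : Subgroup E :=
  N.toAddSubgroup.toSubgroup.map X.inclHom

theorem mem_inclSubgroup {N : Submodule ℤ L} {e : E} :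
    e ∈ X.inclSubgroup N ↔ ∃ l ∈ N, X.incl l = e := Iff.rfl

theorem incl_mem_inclSubgroup {N : Submodule ℤ L} {l : L} :
    X.incl l ∈ X.inclSubgroup N ↔ l ∈ N := by
  rw [mem_inclSubgroup]
  constructor
  · rintro ⟨m, hm, h⟩
    rwa [← X.incl_injective h]
  · exact fun h => ⟨l, h, rfl⟩

theorem inclSubgroup_normal {N : Submodule ℤ L} (hN : ∀ g, N ≤ N.comap (ρ g)) :
    (X.inclSubgroup N).Normal := by
  constructor
  intro e he g
  obtain ⟨l, hl, rfl⟩ := X.mem_inclSubgroup.1 he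
  rw [X.conj_incl, X.incl_mem_inclSubgroup]
  exact hN _ hl

/-- The extension `1 → L / N → E / N → Q → 1` for a `Q`-stable submodule `N` of `L`. -/
noncomputable def quotient {N : Submodule ℤ L} (hN : ∀ g, N ≤ N.comap (ρ g))
    [(X.inclSubgroup N).Normal] :
    LatticeExtension (E ⧸ X.inclSubgroup N) (ρ.quotient N hN) where
  incl := fun l => Quotient.liftOn' l (fun l => ((X.incl l : E) : E ⧸ X.inclSubgroup N)) (by
    intro a b hab
    rw [QuotientGroup.eq, ← X.incl_neg, ← X.incl_add, X.incl_mem_inclSubgroup]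
    exact (Submodule.quotientRel_def N).1 hab |> fun h => by
      have := N.neg_mem h
      rwa [neg_sub, sub_eq_neg_add] at this)
  proj := QuotientGroup.lift (X.inclSubgroup N) X.proj (by
    intro e he
    obtain ⟨l, hl, rfl⟩ := X.mem_inclSubgroup.1 he
    exact X.proj_incl l)
  incl_add := by
    intro a b
    obtain ⟨a, rfl⟩ := N.mkQ_surjective a
    obtain ⟨b, rfl⟩ := N.mkQ_surjective b
    exact congrArg (QuotientGroup.mk (s := X.inclSubgroup N)) (X.incl_add a b)
  incl_injective := by
    intro a b h
    obtain ⟨a, rfl⟩ := N.mkQ_surjective a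
    obtain ⟨b, rfl⟩ := N.mkQ_surjective b
    have h' : (X.incl a : E ⧸ X.inclSubgroup N) = X.incl b := h
    rw [QuotientGroup.eq, ← X.incl_neg, ← X.incl_add, X.incl_mem_inclSubgroup] at h'
    refine ((Submodule.Quotient.eq N).2 ?_)
    have := N.neg_mem h'
    rwa [neg_add, neg_neg, ← sub_eq_add_neg] at this
  proj_surjective := by
    intro q
    obtain ⟨e, rfl⟩ := X.proj_surjective q
    exact ⟨e, rfl⟩
  proj_eq_one_iff := by
    intro e
    obtain ⟨e, rfl⟩ := QuotientGroup.mk_surjective e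
    constructor
    · intro h
      obtain ⟨l, rfl⟩ := (X.proj_eq_one_iff e).1 h
      exact ⟨N.mkQ l, rfl⟩
    · rintro ⟨l, hl⟩
      obtain ⟨l, rfl⟩ := N.mkQ_surjective l
      rw [← hl]
      exact X.proj_incl l
  conj_incl := by
    intro e l
    obtain ⟨e, rfl⟩ := QuotientGroup.mk_surjective e
    obtain ⟨l, rfl⟩ := N.mkQ_surjective l
    exact congrArg (QuotientGroup.mk (s := X.inclSubgroup N)) (X.conj_incl e l)

/-- The group `E / N` has no torsion, expressed in terms of the elements of `E`. -/
theorem hasNoTorsion_quotient_iff {N : Submodule ℤ L} [(X.inclSubgroup N).Normal] :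
    HasNoTorsion (E ⧸ X.inclSubgroup N) ↔
      ∀ (e : E) (k : ℕ), 0 < k → e ^ k ∈ X.inclSubgroup N → e ∈ X.inclSubgroup N := by
  constructor
  · intro h e k hk he
    rw [← QuotientGroup.eq_one_iff] at he ⊢
    exact h _ k hk he
  · intro h e k hk he
    obtain ⟨e, rfl⟩ := QuotientGroup.mk_surjective e
    rw [QuotientGroup.eq_one_iff]
    exact h e k hk ((QuotientGroup.eq_one_iff _).1 he)

theorem isTorsionFree_of_hasNoTorsion (X : LatticeExtension E ρ) (hE : HasNoTorsion E) :
    Module.IsTorsionFree ℤ L := by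
  have h : ∀ (n : ℕ) (l : L), 0 < n → n • l = 0 → l = 0 := by
    intro n l hn hl
    rw [← X.incl_eq_one_iff]
    exact hE _ n hn (by rw [← X.incl_nsmul, hl, X.incl_zero])
  refine Module.IsTorsionFree.of_smul_eq_zero fun n l hl => ?_
  rcases Nat.eq_zero_or_pos n.natAbs with h0 | h0
  · exact Or.inl (Int.natAbs_eq_zero.1 h0)
  · refine Or.inr (h _ l h0 ?_)
    rcases Int.natAbs_eq n with h1 | h1
    · rw [h1, natCast_zsmul] at hl
      exact hl
    · rw [h1, neg_smul, natCast_zsmul, neg_eq_zero] at hl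
      exact hl

/-- Passing from `E / N` to `E / M` for a smaller submodule `M` creates no torsion as long as
`L / M` has none: an element of `E` with a power in `M` lies in `N`, hence in `L`. -/
theorem hasNoTorsion_quotient_of_le {M N : Submodule ℤ L} [(X.inclSubgroup M).Normal]
    [(X.inclSubgroup N).Normal] (hMN : M ≤ N) [Module.IsTorsionFree ℤ (L ⧸ M)]
    (h : HasNoTorsion (E ⧸ X.inclSubgroup N)) : HasNoTorsion (E ⧸ X.inclSubgroup M) := by
  rw [hasNoTorsion_quotient_iff] at h ⊢
  intro e k hk he
  obtain ⟨l, hl, hle⟩ := X.mem_inclSubgroup.1 he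
  obtain ⟨m, -, rfl⟩ := X.mem_inclSubgroup.1
    (h e k hk (X.mem_inclSubgroup.2 ⟨l, hMN hl, hle⟩))
  rw [← X.incl_nsmul, X.incl_mem_inclSubgroup] at he
  rw [X.incl_mem_inclSubgroup]
  rw [← Submodule.Quotient.mk_eq_zero] at he ⊢
  rw [Submodule.Quotient.mk_smul, ← natCast_zsmul] at he
  exact (smul_eq_zero.1 he).resolve_left (by exact_mod_cast hk.ne')

/-- A set-theoretic section of the projection. -/
noncomputable def sec (q : Q) : E := (X.proj_surjective q).choose

@[simp] theorem proj_sec (q : Q) : X.proj (X.sec q) = q := (X.proj_surjective q).choose_spec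

/-- The failure of the section to commute with left multiplication by `e`: the element `λ(e, q)` of
`L` with `e * sec q = λ(e, q) * sec (e q)`. -/
noncomputable def defect (e : E) (q : Q) : L :=
  (X.exists_incl_mul_eq (e := e * X.sec q) (f := X.sec (X.proj e * q)) (by simp)).choose

theorem incl_defect_mul (e : E) (q : Q) :
    X.incl (X.defect e q) * X.sec (X.proj e * q) = e * X.sec q :=
  (X.exists_incl_mul_eq (e := e * X.sec q) (f := X.sec (X.proj e * q)) (by simp)).choose_spec

/-- In the first argument the defect satisfies the law of a crossed homomorphism, up to a
translation of `q`, which disappears on averaging over `q`. -/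
theorem defect_mul (e f : E) (q : Q) :
    X.defect (e * f) q = X.defect e (X.proj f * q) + ρ (X.proj e) (X.defect f q) := by
  apply X.incl_injective
  rw [add_comm, X.incl_add]
  apply mul_right_cancel (b := X.sec (X.proj (e * f) * q))
  rw [X.incl_defect_mul, mul_assoc (X.incl _), map_mul, mul_assoc (X.proj e), X.incl_defect_mul,
    ← mul_assoc, ← X.mul_incl, mul_assoc e, mul_assoc e, X.incl_defect_mul]

theorem defect_incl (l : L) (q : Q) : X.defect (X.incl l) q = l := by
  apply X.incl_injective
  apply mul_right_cancel (b := X.sec (X.proj (X.incl l) * q))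
  rw [X.incl_defect_mul, X.proj_incl, one_mul]

/-- The power of an element `e` of `E`, when it lies in `L`, is fixed by the image of `e` in `Q`,
because it commutes with `e`. -/
theorem rho_eq_self_of_incl_eq_pow {e : E} {r : ℕ} {x : L} (hx : X.incl x = e ^ r) :
    ρ (X.proj e) x = x := by
  apply X.incl_injective
  rw [← X.conj_incl, hx, ← pow_succ', pow_succ, mul_inv_cancel_right]

/-- The power formula `(l e)ʳ = (∑_{i < r} eⁱ l) eʳ`. -/
theorem incl_mul_pow (l : L) (e : E) (r : ℕ) :
    (X.incl l * e) ^ r = X.incl (∑ i ∈ Finset.range r, ρ (X.proj e ^ i) l) * e ^ r := by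
  induction r with
  | zero => simp [X.incl_zero]
  | succ r ih =>
    rw [pow_succ, ih, Finset.sum_range_succ, X.incl_add, mul_assoc, mul_assoc,
      ← mul_assoc (e ^ r), X.mul_incl, map_pow, mul_assoc, ← pow_succ]

end LatticeExtension

/-! ### Special classes and torsion-free extensions -/

namespace LatticeExtension

variable {E Q L : Type*} [Group E] [Group Q] [AddCommGroup L] {ρ : Representation ℤ Q L}
  (X : LatticeExtension E ρ)

/-- A torsion element of `E` generates a subgroup that maps isomorphically onto a nontrivial
subgroup `H` of `Q`, and so yields a splitting of the extension over `H`; conversely the image of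
a splitting over `H` is a torsion subgroup. Here `t` is a section of the projection with factor set
`a`, and a splitting over `H` is a cochain `x` with coboundary `a`. -/
theorem hasNoTorsion_iff_forall_not_coboundary [Finite Q] [Module.IsTorsionFree ℤ L]
    {t : Q → E} (ht : ∀ q, X.proj (t q) = q) {a : Q × Q → L}
    (ha : ∀ g h, t g * t h = X.incl (a (g, h)) * t (g * h)) :
    HasNoTorsion E ↔ ∀ H : Subgroup Q, H ≠ ⊥ →
      ¬ ∃ x : H → L, ∀ g h : H, ρ g (x h) - x (g * h) + x g = a (g, h) := by
  constructor
  · rintro hE H hH ⟨x, hx⟩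
    -- The cochain corrects the section `t` to a homomorphism on `H`.
    let s : H →* E := MonoidHom.mk' (fun h => X.incl (-x h) * t h) (by
      intro g h
      have h1 : -x (g * h) = -x g + ρ g (-x h) + a (g, h) := by
        rw [← hx g h, map_neg]
        abel
      have h2 := X.mul_incl (t g) (-x h)
      rw [ht] at h2
      rw [mul_assoc, ← mul_assoc (t g), h2, mul_assoc (X.incl _) (t g), ha, h1, X.incl_add,
        X.incl_add]
      simp only [mul_assoc, Subgroup.coe_mul])
    obtain ⟨h, hh, hne⟩ := H.bot_or_exists_ne_one.resolve_left hH
    have h1 : s ⟨h, hh⟩ = 1 :=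
      hE _ (Nat.card H) Nat.card_pos (by rw [← map_pow, pow_card_eq_one', map_one])
    apply hne
    have h2 := congrArg X.proj h1
    rw [map_one] at h2
    rw [← h2]
    change h = X.proj (X.incl _ * t h)
    rw [map_mul, X.proj_incl, one_mul, ht]
  · intro hH e k hk he
    by_contra hne
    -- The cyclic group generated by `e` meets the torsion-free group `L` trivially, hence maps
    -- isomorphically onto its image in `Q`; the splitting `s` below is the inverse map.
    have tors : ∀ f ∈ Subgroup.zpowers e, X.proj f = 1 → f = 1 := by
      intro f hf h1
      obtain ⟨l, rfl⟩ := (X.proj_eq_one_iff f).1 h1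
      obtain ⟨n, hn⟩ := Subgroup.mem_zpowers_iff.1 hf
      have h2 : X.incl (k • l) = 1 := by
        rw [X.incl_nsmul, ← hn, ← zpow_natCast, ← zpow_mul, mul_comm, zpow_mul, zpow_natCast, he,
          one_zpow]
      rw [X.incl_eq_one_iff, ← natCast_zsmul] at h2
      rw [X.incl_eq_one_iff]
      exact (smul_eq_zero.1 h2).resolve_left (by exact_mod_cast hk.ne')
    refine hH (Subgroup.zpowers (X.proj e)) ?_ ?_
    · rw [Ne, Subgroup.zpowers_eq_bot]
      exact fun h => hne (tors e (Subgroup.mem_zpowers e) h)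
    · have hs : ∀ h : Subgroup.zpowers (X.proj e), ∃ f ∈ Subgroup.zpowers e, X.proj f = h := by
        rintro ⟨h, hh⟩
        obtain ⟨n, rfl⟩ := Subgroup.mem_zpowers_iff.1 hh
        exact ⟨e ^ n, Subgroup.mem_zpowers_iff.2 ⟨n, rfl⟩, map_zpow _ _ _⟩
      choose s hs1 hs2 using hs
      have hmul : ∀ g h, s g * s h = s (g * h) := by
        intro g h
        rw [← mul_inv_eq_one]
        refine tors _ (mul_mem (mul_mem (hs1 _) (hs1 _)) (inv_mem (hs1 _))) ?_
        rw [map_mul, map_mul, map_inv, hs2, hs2, hs2, Subgroup.coe_mul, mul_inv_cancel]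
      have hx : ∀ h : Subgroup.zpowers (X.proj e), ∃ l, X.incl l * s h = t h := fun h =>
        X.exists_incl_mul_eq (by rw [ht, hs2])
      choose x hx using hx
      refine ⟨x, fun g h => ?_⟩
      have h1 : X.incl (x g + ρ g (x h)) * s (g * h) =
          X.incl (a (g, h) + x (g * h)) * s (g * h) := by
        rw [X.incl_add, X.incl_add, mul_assoc _ _ (s (g * h)), mul_assoc _ _ (s (g * h)), hx,
          Subgroup.coe_mul, ← ha, ← hx g, ← hx h, ← hmul]
        have h2 := X.mul_incl (s g) (x h)
        rw [hs2] at h2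
        rw [mul_assoc (X.incl (x g)) (s g), ← mul_assoc (s g), h2]
        simp only [mul_assoc]
      have h3 := X.incl_injective (mul_right_cancel h1)
      rw [add_comm, ← sub_eq_iff_eq_add] at h3
      rw [← h3]
      abel

end LatticeExtension

section

variable {Q L : Type} [Group Q] [AddCommGroup L] {ρ : Representation ℤ Q L}

open groupCohomology

theorem map_subtype_H2π_eq_zero_iff (A : Rep.{0} ℤ Q) (a : cocycles₂ A) (H : Subgroup Q) :
    groupCohomology.map H.subtype (𝟙 (Rep.res H.subtype A)) 2 (H2π A a) = 0 ↔
      ∃ x : H → A, ∀ g h : H, A.ρ g (x h) - x (g * h) + x g = a (g, h) := by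
  have h : groupCohomology.map H.subtype (𝟙 (Rep.res H.subtype A)) 2 (H2π A a) =
      H2π (Rep.res H.subtype A) (mapCocycles₂ H.subtype (𝟙 (Rep.res H.subtype A)) a) := by
    apply H2π_comp_map_apply H.subtype (𝟙 (Rep.res H.subtype A)) a
  rw [h]
  refine (H2π_eq_zero_iff (A := Rep.res H.subtype A) _).trans ?_
  constructor
  · rintro ⟨x, hx⟩
    exact ⟨x, fun g h => congrFun hx (g, h)⟩
  · rintro ⟨x, hx⟩
    exact ⟨x, funext fun gh => hx gh.1 gh.2⟩

theorem isSpecialClass_H2π_iff (A : Rep.{0} ℤ Q) (a : cocycles₂ A) :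
    IsSpecialClass A (H2π A a) ↔ ∀ H : Subgroup Q, H ≠ ⊥ →
      ¬ ∃ x : H → A, ∀ g h : H, A.ρ g (x h) - x (g * h) + x g = a (g, h) := by
  exact forall_congr' fun H => imp_congr_right fun _ =>
    not_congr (map_subtype_H2π_eq_zero_iff A a H)

theorem map_id_H2π {A B : Rep.{0} ℤ Q} (φ : A ⟶ B) (a : cocycles₂ A) :
    (groupCohomology.functor ℤ Q 2).map φ (H2π A a) =
      H2π B (mapCocycles₂ (MonoidHom.id Q) φ a) := by
  apply H2π_comp_map_apply (MonoidHom.id Q) φ a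

theorem map_mkQ_H2π (N : Submodule ℤ L) (hN : ∀ g, N ≤ N.comap (ρ g))
    (a : cocycles₂ (Rep.of ρ)) :
    ∃ b : cocycles₂ ((Rep.of ρ).quotient N hN), (∀ g h, b (g, h) = N.mkQ (a (g, h))) ∧
      (groupCohomology.functor ℤ Q 2).map ((Rep.of ρ).mkQ N hN) (H2π _ a) = H2π _ b := by
  refine ⟨mapCocycles₂ (MonoidHom.id Q) ((Rep.of ρ).mkQ N hN) a, fun g h => rfl, ?_⟩
  exact map_id_H2π _ a

/-- The underlying set `L × Q` of the extension of `Q` by `L` with a given factor set. -/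
@[ext]
structure CocycleExtension (a : cocycles₂ (Rep.of ρ)) : Type where
  /-- The component in `L`. -/
  left : L
  /-- The component in `Q`. -/
  right : Q

namespace CocycleExtension

variable (a : cocycles₂ (Rep.of ρ))

instance : Mul (CocycleExtension a) :=
  ⟨fun x y => ⟨x.left + ρ x.right y.left + a (x.right, y.right), x.right * y.right⟩⟩

instance : One (CocycleExtension a) := ⟨⟨-a (1, 1), 1⟩⟩

instance : Inv (CocycleExtension a) :=
  ⟨fun x => ⟨-(ρ x.right⁻¹ x.left + a (x.right⁻¹, x.right) + a (1, 1)), x.right⁻¹⟩⟩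

theorem mul_def (x y : CocycleExtension a) :
    x * y = ⟨x.left + ρ x.right y.left + a (x.right, y.right), x.right * y.right⟩ := rfl

theorem one_def : (1 : CocycleExtension a) = ⟨-a (1, 1), 1⟩ := rfl

theorem inv_def (x : CocycleExtension a) :
    x⁻¹ = ⟨-(ρ x.right⁻¹ x.left + a (x.right⁻¹, x.right) + a (1, 1)), x.right⁻¹⟩ := rfl

theorem cocycle (g h j : Q) : a (g * h, j) + a (g, h) = ρ g (a (h, j)) + a (g, h * j) :=
  (mem_cocycles₂_iff (A := Rep.of ρ) a).1 a.2 g h j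

instance : Group (CocycleExtension a) :=
  Group.ofLeftAxioms
    (by
      intro x y z
      ext
      · simp only [mul_def, map_add, map_mul, Module.End.mul_apply]
        have h := cocycle a x.right y.right z.right
        rw [add_assoc, add_assoc, add_assoc, add_assoc, add_assoc, add_assoc, ← h]
        abel
      · exact mul_assoc _ _ _)
    (by
      intro x
      ext
      · have h := cocycles₂_map_one_fst a x.right
        simp [mul_def, one_def, h]
      · exact one_mul _)
    (by
      intro x
      ext
      · simp [mul_def, one_def, inv_def]
        abel
      · exact inv_mul_cancel _)

/-- The extension of `Q` by `L` with factor set `a`. -/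
def latticeExtension : LatticeExtension (CocycleExtension a) ρ where
  incl l := ⟨l - a (1, 1), 1⟩
  proj := ⟨⟨right, rfl⟩, fun _ _ => rfl⟩
  incl_add l m := by
    ext
    · simp [mul_def]
      abel
    · exact (one_mul _).symm
  incl_injective l m h := sub_left_injective (congrArg left h)
  proj_surjective q := ⟨⟨0, q⟩, rfl⟩
  proj_eq_one_iff x := by
    constructor
    · intro h
      exact ⟨x.left + a (1, 1), CocycleExtension.ext (add_sub_cancel_right _ _) h.symm⟩
    · rintro ⟨l, rfl⟩
      rfl
  conj_incl x l := by
    rw [mul_inv_eq_iff_eq_mul]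
    have h1 := cocycles₂_map_one_fst a x.right
    have h2 := cocycles₂_map_one_snd a x.right
    ext
    · simp only [mul_def, MonoidHom.coe_mk, OneHom.coe_mk, map_sub, map_one, Module.End.one_apply,
        h1, h2]
      change _ + (_ - ρ _ _) + ρ _ _ = _
      abel
    · simp [mul_def]

theorem mk_zero_mul_mk_zero (g h : Q) :
    (⟨0, g⟩ * ⟨0, h⟩ : CocycleExtension a) =
      (latticeExtension a).incl (a (g, h)) * ⟨0, g * h⟩ := by
  have h1 := cocycles₂_map_one_fst a (g * h)
  ext
  · simp [mul_def, latticeExtension, h1]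
  · simp [mul_def, latticeExtension]

end CocycleExtension

/-- A class is special if and only if the extension that it classifies has no torsion. -/
theorem isSpecialClass_iff_hasNoTorsion [Finite Q] [Module.IsTorsionFree ℤ L]
    {E : Type*} [Group E] (X : LatticeExtension E ρ) {t : Q → E} (ht : ∀ q, X.proj (t q) = q)
    (a : cocycles₂ (Rep.of ρ)) (ha : ∀ g h, t g * t h = X.incl (a (g, h)) * t (g * h)) :
    IsSpecialClass (Rep.of ρ) (H2π _ a) ↔ HasNoTorsion E := by
  rw [isSpecialClass_H2π_iff, X.hasNoTorsion_iff_forall_not_coboundary ht ha]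

theorem isSpecialClass_quotient_iff_hasNoTorsion [Finite Q]
    {E : Type*} [Group E] (X : LatticeExtension E ρ) {t : Q → E} (ht : ∀ q, X.proj (t q) = q)
    (a : cocycles₂ (Rep.of ρ)) (ha : ∀ g h, t g * t h = X.incl (a (g, h)) * t (g * h))
    (N : Submodule ℤ L) (hN : ∀ g, N ≤ N.comap (ρ g)) [Module.IsTorsionFree ℤ (L ⧸ N)]
    [(X.inclSubgroup N).Normal] :
    IsSpecialClass ((Rep.of ρ).quotient N hN)
        ((groupCohomology.functor ℤ Q 2).map ((Rep.of ρ).mkQ N hN) (H2π _ a)) ↔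
      HasNoTorsion (E ⧸ X.inclSubgroup N) := by
  obtain ⟨b, hb, h⟩ := map_mkQ_H2π N hN a
  rw [h]
  refine isSpecialClass_iff_hasNoTorsion (X.quotient hN)
    (t := fun q => (t q : E ⧸ X.inclSubgroup N)) (fun q => ht q) b fun g h => ?_
  rw [hb]
  exact congrArg (QuotientGroup.mk (s := X.inclSubgroup N)) (ha g h)

/-- The factor set of an extension with respect to a section. -/
theorem LatticeExtension.exists_cocycle {E : Type*} [Group E] (X : LatticeExtension E ρ) :
    ∃ a : cocycles₂ (Rep.of ρ), ∀ g h, X.sec g * X.sec h = X.incl (a (g, h)) * X.sec (g * h) := by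
  have hd : ∀ g h, X.sec g * X.sec h = X.incl (X.defect (X.sec g) h) * X.sec (g * h) := by
    intro g h
    have := X.incl_defect_mul (X.sec g) h
    rw [X.proj_sec] at this
    exact this.symm
  refine ⟨⟨fun gh => X.defect (X.sec gh.1) gh.2, ?_⟩, hd⟩
  rw [mem_cocycles₂_iff]
  intro g h j
  change X.defect (X.sec (g * h)) j + X.defect (X.sec g) h =
    ρ g (X.defect (X.sec h) j) + X.defect (X.sec g) (h * j)
  have h1 := X.defect_mul (X.sec g) (X.sec h) j
  rw [hd g h, X.defect_mul, X.defect_incl, X.proj_incl, map_one, X.proj_sec, X.proj_sec] at h1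
  rw [add_comm, add_comm (ρ g _), ← h1]
  rfl

/-- The property `IsVasquezBound` in terms of extensions: each torsion-free extension by a faithful
lattice has a torsion-free quotient extension by a lattice of rank at most `n`. -/
theorem IsVasquezBound.exists_submodule {G : Type*} [Group G] [Finite G] {n : ℕ}
    (hn : IsVasquezBound G n) (hQ : Nonempty (Q ≃* G)) [Module.Free ℤ L] [Module.Finite ℤ L]
    (hρ : Function.Injective ρ) {E : Type*} [Group E] (X : LatticeExtension E ρ)
    (hE : HasNoTorsion E) :
    ∃ (N : Submodule ℤ L) (_ : ∀ g, N ≤ N.comap (ρ g)) (_ : (X.inclSubgroup N).Normal),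
      Module.finrank ℤ (L ⧸ N) ≤ n ∧ Module.IsTorsionFree ℤ (L ⧸ N) ∧
      HasNoTorsion (E ⧸ X.inclSubgroup N) := by
  have : Finite Q := Finite.of_equiv G hQ.some.symm
  obtain ⟨a, ha⟩ := X.exists_cocycle
  obtain ⟨N, hN, h1, h2, h3⟩ := hn Q hQ L ρ hρ (H2π _ a)
    ((isSpecialClass_iff_hasNoTorsion X X.proj_sec a ha).2 hE)
  have := X.inclSubgroup_normal hN
  exact ⟨N, hN, this, h2, h1,
    (isSpecialClass_quotient_iff_hasNoTorsion X X.proj_sec a ha N hN).1 h3⟩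

end

/-- To establish `IsVasquezBound` it suffices to treat torsion-free extensions. -/
theorem isVasquezBound_of_extension {G : Type*} [Group G] [Finite G] {n : ℕ}
    (h : ∀ (Q : Type) [Group Q], Nonempty (Q ≃* G) →
      ∀ (L : Type) [AddCommGroup L] [Module.Free ℤ L] [Module.Finite ℤ L]
        (ρ : Representation ℤ Q L), Function.Injective ρ →
        ∀ (E : Type) [Group E] (X : LatticeExtension E ρ), HasNoTorsion E →
          ∃ (N : Submodule ℤ L) (_ : ∀ g, N ≤ N.comap (ρ g)) (_ : (X.inclSubgroup N).Normal),
            Module.finrank ℤ (L ⧸ N) ≤ n ∧ HasNoTorsion (E ⧸ X.inclSubgroup N)) :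
    IsVasquezBound G n := by
  intro Q _ hQ L _ _ _ ρ hρ α hα
  have : Finite Q := Finite.of_equiv G hQ.some.symm
  induction α using groupCohomology.H2_induction_on with | @h a =>
  let X := CocycleExtension.latticeExtension a
  have ht : ∀ q, X.proj (⟨0, q⟩ : CocycleExtension a) = q := fun _ => rfl
  have ha := CocycleExtension.mk_zero_mul_mk_zero a
  obtain ⟨N, hN, _, h1, h2⟩ := h Q hQ L ρ hρ _ X
    ((isSpecialClass_iff_hasNoTorsion X ht a ha).1 hα)
  have := (X.quotient hN).isTorsionFree_of_hasNoTorsion h2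
  exact ⟨N, hN, this, h1, (isSpecialClass_quotient_iff_hasNoTorsion X ht a ha N hN).2 h2⟩

/-! ### Existence of the Vasquez number -/

namespace LatticeExtension

variable {E Q L : Type*} [Group E] [Group Q] [AddCommGroup L] {ρ : Representation ℤ Q L}
  (X : LatticeExtension E ρ)

/-- Let `c ≠ 1` have order `r` and let `x₀ ∈ L` be the `r`-th power of a lift of `c`. With
`Nm = 1 + c + ⋯ + c^(r-1)`, the lifts of `c` have `r`-th powers `x₀ + Nm l`. Since none of them is
trivial, `r x₀ = Nm x₀` is not divisible by `r` in the lattice `Nm L`, so some coordinate of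
`Nm x₀` is not divisible by `r`, and this coordinate of `Nm` vanishes on no `x₀ + Nm l`. -/
theorem exists_functional [Finite Q] [Module.Free ℤ L] [Module.Finite ℤ L] (hE : HasNoTorsion E)
    {c : Q} (hc : c ≠ 1) :
    ∃ f : L →ₗ[ℤ] ℤ, ∀ (e : E) (x : L), X.proj e = c → X.incl x = e ^ orderOf c → f x ≠ 0 := by
  set r := orderOf c with hr
  have hr0 : 0 < r := orderOf_pos c
  obtain ⟨x₀, hx₀⟩ : ∃ x, X.incl x = X.sec c ^ r :=
    (X.proj_eq_one_iff _).1 (by rw [map_pow, X.proj_sec, pow_orderOf_eq_one])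
  let Nm : L →ₗ[ℤ] L := ∑ i ∈ Finset.range r, ρ (c ^ i)
  have hNm : ∀ l, Nm l = ∑ i ∈ Finset.range r, ρ (c ^ i) l := fun l => by simp [Nm]
  have hfix : ∀ y, ρ c y = y → Nm y = (r : ℤ) • y := by
    intro y hy
    rw [hNm]
    have : ∀ i, ρ (c ^ i) y = y := by
      intro i
      induction i with
      | zero => simp
      | succ i ih => rw [pow_succ, map_mul, Module.End.mul_apply, hy, ih]
    rw [Finset.sum_congr rfl fun i _ => this i, Finset.sum_const, Finset.card_range,
      natCast_zsmul]
  have hpow : ∀ (e : E) (x : L), X.proj e = c → X.incl x = e ^ r → ρ c x = x := by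
    intro e x he hx
    have := X.rho_eq_self_of_incl_eq_pow hx
    rwa [he] at this
  have hlift : ∀ (e : E) (x : L), X.proj e = c → X.incl x = e ^ r →
      ∃ l, x = Nm l + x₀ := by
    intro e x he hx
    obtain ⟨l, hl⟩ := X.exists_incl_mul_eq (e := e) (f := X.sec c) (by rw [he, X.proj_sec])
    refine ⟨l, X.incl_injective ?_⟩
    rw [hx, ← hl, X.incl_mul_pow, X.proj_sec, ← hNm, X.incl_add, hx₀]
  have hNmNm : ∀ l, Nm (Nm l) = (r : ℤ) • Nm l := by
    intro l
    apply hfix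
    have h1 := hpow (X.incl l * X.sec c) (Nm l + x₀) (by simp [X.proj_incl])
      (by rw [X.incl_mul_pow, X.proj_sec, ← hNm, X.incl_add, hx₀])
    have h2 := hpow (X.sec c) x₀ (X.proj_sec c) hx₀
    rw [map_add, h2] at h1
    exact add_right_cancel h1
  have hdiv : ∀ y, Nm x₀ ≠ (r : ℤ) • Nm y := by
    intro y hy
    rw [hfix x₀ (hpow _ _ (X.proj_sec c) hx₀)] at hy
    have hy' : x₀ = Nm y := smul_right_injective L (by exact_mod_cast hr0.ne') hy
    have h1 : (X.incl (-y) * X.sec c) ^ r = 1 := by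
      rw [X.incl_mul_pow, X.proj_sec, ← hNm, ← hx₀, ← X.incl_add, map_neg, ← hy', neg_add_cancel,
        X.incl_zero]
    have h2 := congrArg X.proj (hE _ r hr0 h1)
    rw [map_mul, X.proj_incl, one_mul, X.proj_sec, map_one] at h2
    exact hc h2
  -- `b.coord i` is a coordinate of the lattice `Nm L` in which `Nm x₀` is not divisible by `r`.
  let b := Module.Free.chooseBasis ℤ (LinearMap.range Nm)
  let N' := Nm.rangeRestrict
  obtain ⟨i, hi⟩ : ∃ i, ¬ (r : ℤ) ∣ b.repr (N' x₀) i := by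
    by_contra! h
    choose d hd using h
    obtain ⟨⟨_, y, rfl⟩, hz⟩ : ∃ z : LinearMap.range Nm, N' x₀ = (r : ℤ) • z := by
      refine ⟨∑ i, d i • b i, ?_⟩
      rw [← b.sum_repr (N' x₀), Finset.smul_sum]
      exact Finset.sum_congr rfl fun i _ => by rw [hd, mul_smul]
    exact hdiv y (congrArg Subtype.val hz)
  refine ⟨b.coord i ∘ₗ N', fun e x he hx h0 => hi ?_⟩
  obtain ⟨l, rfl⟩ := hlift e x he hx
  have h1 : N' (Nm l) = (r : ℤ) • N' l := Subtype.ext (hNmNm l)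
  rw [LinearMap.comp_apply, map_add, h1, map_add, map_smul, Module.Basis.coord_apply,
    Module.Basis.coord_apply] at h0
  refine ⟨-(b.repr (N' l) i), ?_⟩
  rw [smul_eq_mul] at h0
  linarith

end LatticeExtension

/-- Vasquez's theorem: the functionals of `LatticeExtension.exists_functional`, one for each
nontrivial element of the group, together with their translates, embed a suitable quotient of the
lattice into `ℤ^(|G|²)`. -/
theorem isVasquezBound_card_sq (G : Type*) [Group G] [Finite G] :
    IsVasquezBound G (Nat.card G ^ 2) := by
  refine isVasquezBound_of_extension fun Q _ hQ L _ _ _ ρ hρ E _ X hE => ?_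
  have : Finite Q := Finite.of_equiv G hQ.some.symm
  have := Fintype.ofFinite Q
  have hf : ∀ c : Q, ∃ f : L →ₗ[ℤ] ℤ, c ≠ 1 → ∀ (e : E) (x : L), X.proj e = c →
      X.incl x = e ^ orderOf c → f x ≠ 0 := by
    intro c
    by_cases hc : c = 1
    · exact ⟨0, fun h => absurd hc h⟩
    · obtain ⟨f, hf⟩ := X.exists_functional hE hc
      exact ⟨f, fun _ => hf⟩
  choose f hf using hf
  let F : L →ₗ[ℤ] (Q × Q → ℤ) := LinearMap.pi fun p => f p.1 ∘ₗ ρ p.2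
  have hF : ∀ l p, F l p = f p.1 (ρ p.2 l) := fun _ _ => rfl
  have hN : ∀ g, LinearMap.ker F ≤ (LinearMap.ker F).comap (ρ g) := by
    intro g l hl
    rw [Submodule.mem_comap, LinearMap.mem_ker]
    funext p
    rw [hF, ← Module.End.mul_apply, ← map_mul]
    exact congrFun (LinearMap.mem_ker.1 hl) (p.1, p.2 * g)
  have hnormal := X.inclSubgroup_normal hN
  refine ⟨LinearMap.ker F, hN, hnormal, ?_, ?_⟩
  · rw [F.quotKerEquivRange.finrank_eq]
    refine (Submodule.finrank_le _).trans ?_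
    rw [Module.finrank_fintype_fun_eq_card, Fintype.card_prod, ← Nat.card_eq_fintype_card,
      Nat.card_congr hQ.some.toEquiv, sq]
  · rw [X.hasNoTorsion_quotient_iff]
    intro e k hk he
    have hk' : (k : ℤ) ≠ 0 := by exact_mod_cast hk.ne'
    have hker : ∀ x : L, X.incl x ^ k ∈ X.inclSubgroup (LinearMap.ker F) → F x = 0 := by
      intro x hx
      rw [← X.incl_nsmul, X.incl_mem_inclSubgroup, LinearMap.mem_ker, ← natCast_zsmul,
        map_smul] at hx
      exact (smul_eq_zero.1 hx).resolve_left hk'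
    -- An element with a power in `N` lies in `L`, since the functional of its image `c ≠ 1` would
    -- not vanish on `e ^ orderOf c`; and `L / N` has no torsion.
    by_cases hc : X.proj e = 1
    · obtain ⟨l, rfl⟩ := (X.proj_eq_one_iff e).1 hc
      exact X.incl_mem_inclSubgroup.2 (LinearMap.mem_ker.2 (hker l he))
    · exfalso
      obtain ⟨x, hx⟩ := (X.proj_eq_one_iff (e ^ orderOf (X.proj e))).1
        (by rw [map_pow, pow_orderOf_eq_one])
      refine hf _ hc e x rfl hx ?_
      have h1 := hker x (by rw [hx, ← pow_mul, mul_comm, pow_mul]; exact pow_mem he _)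
      have h2 := congrFun h1 (X.proj e, 1)
      rwa [hF, map_one] at h2

/-! ### Representations of finite groups in characteristic zero -/

namespace Representation

section CommRing

variable {k G V : Type*} [CommRing k] [Monoid G] [AddCommGroup V] [Module k V]

/-- Extension of scalars of a representation. -/
noncomputable def extendScalars (K : Type*) [CommRing K] [Algebra k K] (ρ : Representation k G V) :
    Representation K G (K ⊗[k] V) :=
  (Module.End.baseChangeHom k K V : Module.End k V →* Module.End K (K ⊗[k] V)).comp ρ

@[simp]
theorem extendScalars_apply (K : Type*) [CommRing K] [Algebra k K] (ρ : Representation k G V)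
    (g : G) : ρ.extendScalars K g = (ρ g).baseChange K := rfl

/-- Extension of scalars of an intertwining map. -/
noncomputable def IntertwiningMap.extendScalars {W : Type*} [AddCommGroup W] [Module k W]
    {ρ : Representation k G V} {σ : Representation k G W} (K : Type*) [CommRing K] [Algebra k K]
    (f : IntertwiningMap ρ σ) :
    IntertwiningMap (ρ.extendScalars K) (σ.extendScalars K) where
  toLinearMap := f.toLinearMap.baseChange K
  isIntertwining' g := by
    rw [extendScalars_apply, extendScalars_apply, ← LinearMap.baseChange_comp,
      ← LinearMap.baseChange_comp, f.isIntertwining']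

end CommRing

variable {k G V W U : Type*} [Field k] [Group G]
  [AddCommGroup V] [Module k V] [FiniteDimensional k V]
  [AddCommGroup W] [Module k W] [FiniteDimensional k W]
  [AddCommGroup U] [Module k U] [FiniteDimensional k U]
  (ρ : Representation k G V) (σ : Representation k G W) (τ : Representation k G U)

theorem character_extendScalars (K : Type*) [Field K] [Algebra k K] (g : G) :
    (ρ.extendScalars K).character g = algebraMap k K (ρ.character g) :=
  LinearMap.trace_baseChange _ _

theorem character_prod (g : G) : (ρ.prod σ).character g = ρ.character g + σ.character g :=
  LinearMap.trace_prodMap' _ _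

/-- The dimension of the space of equivariant maps. -/
noncomputable def homDim : ℕ := Module.finrank k (IntertwiningMap ρ σ)

theorem homDim_ne_zero_iff : homDim ρ σ ≠ 0 ↔ ∃ f : IntertwiningMap ρ σ, f ≠ 0 := by
  rw [homDim, ← Nat.pos_iff_ne_zero, Module.finrank_pos_iff_exists_ne_zero]

theorem homDim_self_ne_zero [Nontrivial V] : homDim ρ ρ ≠ 0 := by
  rw [homDim_ne_zero_iff]
  obtain ⟨v, hv⟩ := exists_ne (0 : V)
  exact ⟨IntertwiningMap.id ρ, fun h => hv (congrArg (fun f : IntertwiningMap ρ ρ => f v) h)⟩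

variable {ρ σ τ}

theorem IntertwiningMap.exists_apply_ne_zero {f : IntertwiningMap ρ σ} (hf : f ≠ 0) :
    ∃ v, f v ≠ 0 := by
  by_contra! h
  exact hf (IntertwiningMap.ext (LinearMap.ext h))

theorem homDim_ne_zero_of_injective [Nontrivial V] (f : IntertwiningMap ρ σ)
    (hf : Function.Injective f) : homDim ρ σ ≠ 0 := by
  rw [homDim_ne_zero_iff]
  refine ⟨f, fun h => ?_⟩
  obtain ⟨v, hv⟩ := exists_ne (0 : V)
  refine hv (hf ?_)
  rw [h]
  simp

theorem nontrivial_of_isIrreducible (hρ : ρ.IsIrreducible) : Nontrivial V := by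
  by_contra h
  rw [not_nontrivial_iff_subsingleton] at h
  obtain ⟨S, T, hST⟩ := hρ.toNontrivial
  exact hST (Subrepresentation.toSubmodule_injective (Subsingleton.elim _ _))

theorem nonempty_equiv_of_homDim_ne_zero (hρ : ρ.IsIrreducible) (hσ : σ.IsIrreducible)
    (h : homDim ρ σ ≠ 0) : Nonempty (Equiv ρ σ) := by
  obtain ⟨f, hf⟩ := (homDim_ne_zero_iff ρ σ).1 h
  exact ⟨f.ofBijective ((IsIrreducible.bijective_or_eq_zero f).resolve_right hf)⟩

theorem exists_injective_of_homDim_ne_zero (hρ : ρ.IsIrreducible) (h : homDim ρ σ ≠ 0) :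
    ∃ f : IntertwiningMap ρ σ, Function.Injective f := by
  obtain ⟨f, hf⟩ := (homDim_ne_zero_iff ρ σ).1 h
  exact ⟨f, (IsIrreducible.injective_or_eq_zero f).resolve_right hf⟩

/-- The inclusion of a subrepresentation. -/
def _root_.Subrepresentation.subtype (S : Subrepresentation ρ) :
    IntertwiningMap S.toRepresentation ρ :=
  ⟨S.toSubmodule.subtype, fun _ => rfl⟩

theorem exists_irreducible_subrepresentation [Nontrivial V] :
    ∃ S : Subrepresentation ρ, S.toRepresentation.IsIrreducible := by
  classical
  have hex : ∃ n, ∃ S : Subrepresentation ρ, S ≠ ⊥ ∧ Module.finrank k S.toSubmodule = n := by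
    refine ⟨_, ⊤, fun h => ?_, rfl⟩
    have h' : (⊤ : Submodule k V) = ⊥ := congrArg Subrepresentation.toSubmodule h
    exact top_ne_bot h'
  obtain ⟨S, hS, hn⟩ := Nat.find_spec hex
  refine ⟨S, { toNontrivial := ⟨⊥, ⊤, ?_⟩, eq_bot_or_eq_top := ?_ }⟩
  · intro h
    have h' : (⊥ : Submodule k S.toSubmodule) = ⊤ := congrArg Subrepresentation.toSubmodule h
    refine hS (Subrepresentation.toSubmodule_injective ?_)
    have := (subsingleton_iff_bot_eq_top.1 h')
    exact Submodule.subsingleton_iff_eq_bot.1 ((Submodule.subsingleton_iff k).1 this)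
  · intro T
    by_cases hT : T = ⊥
    · exact Or.inl hT
    right
    let T' : Subrepresentation ρ := ⟨T.toSubmodule.map S.toSubmodule.subtype, by
      rintro g _ ⟨v, hv, rfl⟩
      exact ⟨S.toRepresentation g v, T.apply_mem_toSubmodule g hv, rfl⟩⟩
    have hT' : T' ≠ ⊥ := by
      intro h
      have h' : T.toSubmodule.map S.toSubmodule.subtype = ⊥ :=
        congrArg Subrepresentation.toSubmodule h
      refine hT (Subrepresentation.toSubmodule_injective ?_)
      exact Submodule.map_injective_of_injective (Submodule.injective_subtype S.toSubmodule)
        (h'.trans (Submodule.map_bot _).symm)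
    have hmin := Nat.find_min' hex ⟨T', hT', rfl⟩
    rw [← hn] at hmin
    have hfr : Module.finrank k T'.toSubmodule = Module.finrank k T.toSubmodule :=
      (Submodule.equivMapOfInjective S.toSubmodule.subtype Subtype.val_injective
        T.toSubmodule).finrank_eq.symm
    refine Subrepresentation.toSubmodule_injective (Submodule.eq_top_of_finrank_eq ?_)
    exact le_antisymm (Submodule.finrank_le _) (hmin.trans hfr.le)

/-- Maschke's theorem: the image of an equivariant injection is a direct factor. -/
theorem exists_equiv_prod_apply_eq [Finite G] [CharZero k] (f : IntertwiningMap τ ρ)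
    (hf : Function.Injective f) :
    ∃ (S : Subrepresentation ρ) (e : Equiv ρ (τ.prod S.toRepresentation)),
      ∀ u, e (f u) = (u, 0) := by
  have : NeZero (Nat.card G : k) := ⟨Nat.cast_ne_zero.2 Nat.card_pos.ne'⟩
  obtain ⟨S, hS⟩ := exists_isCompl (f.range)
  have hbij : Function.Bijective (f.toLinearMap.coprod S.toSubmodule.subtype) := by
    have hdis : f.toLinearMap.range ⊓ S.toSubmodule = ⊥ :=
      congrArg Subrepresentation.toSubmodule (disjoint_iff.1 hS.disjoint)
    have hcod : f.toLinearMap.range ⊔ S.toSubmodule = ⊤ :=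
      congrArg Subrepresentation.toSubmodule (codisjoint_iff.1 hS.codisjoint)
    constructor
    · rw [← LinearMap.ker_eq_bot, LinearMap.ker_coprod_of_disjoint_range]
      · rw [LinearMap.ker_eq_bot.2 hf, Submodule.ker_subtype, Submodule.prod_bot]
      · rw [Submodule.range_subtype]
        exact disjoint_iff.2 hdis
    · rw [← LinearMap.range_eq_top, LinearMap.range_coprod, Submodule.range_subtype, hcod]
  let e : Equiv (τ.prod S.toRepresentation) ρ := Equiv.mk (LinearEquiv.ofBijective _ hbij) (by
    intro g
    refine LinearMap.ext fun p => ?_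
    change f (τ g p.1) + ρ g p.2 = ρ g (f p.1 + p.2)
    rw [map_add, IntertwiningMap.isIntertwining])
  refine ⟨S, e.symm, fun u => ?_⟩
  have h : e (u, 0) = f u := add_zero (f u)
  rw [← h, Equiv.symm_apply_apply]

theorem exists_equiv_prod_of_injective [Finite G] [CharZero k] (f : IntertwiningMap τ ρ)
    (hf : Function.Injective f) :
    ∃ S : Subrepresentation ρ, Nonempty (Equiv ρ (τ.prod S.toRepresentation)) := by
  obtain ⟨S, e, -⟩ := exists_equiv_prod_apply_eq f hf
  exact ⟨S, ⟨e⟩⟩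

theorem character_eq_add (e : Equiv ρ (τ.prod σ)) :
    ρ.character = τ.character + σ.character := by
  rw [char_iso e]
  funext g
  exact character_prod τ σ g

theorem finrank_eq_add (e : Equiv ρ (τ.prod σ)) :
    Module.finrank k V = Module.finrank k U + Module.finrank k W := by
  rw [e.toLinearEquiv.finrank_eq, Module.finrank_prod]

section Finite

variable [Fintype G] [CharZero k]

variable (ρ σ) in
/-- The first orthogonality relation, for arbitrary representations. -/
theorem homDim_eq_sum :
    (homDim ρ σ : k) = (Nat.card G : k)⁻¹ * ∑ g : G, σ.character g * ρ.character g⁻¹ := by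
  have : Invertible (Nat.card G : k) :=
    invertibleOfNonzero (Nat.cast_ne_zero.2 Nat.card_pos.ne')
  exact (card_inv_mul_sum_char_mul_char_eq_finrank ρ σ).symm

variable (ρ σ) in
theorem homDim_comm : homDim ρ σ = homDim σ ρ := by
  apply Nat.cast_injective (R := k)
  rw [homDim_eq_sum, homDim_eq_sum, ← Equiv.sum_comp (Equiv.inv G)]
  simp [mul_comm]

theorem homDim_add_right {V₁ V₂ : Type*} [AddCommGroup V₁] [Module k V₁] [FiniteDimensional k V₁]
    [AddCommGroup V₂] [Module k V₂] [FiniteDimensional k V₂] {ρ₁ : Representation k G V₁}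
    {ρ₂ : Representation k G V₂} (h : ρ.character = ρ₁.character + ρ₂.character)
    (σ : Representation k G W) : homDim σ ρ = homDim σ ρ₁ + homDim σ ρ₂ := by
  apply Nat.cast_injective (R := k)
  rw [Nat.cast_add, homDim_eq_sum, homDim_eq_sum, homDim_eq_sum, h, ← mul_add,
    ← Finset.sum_add_distrib]
  simp [add_mul]

theorem homDim_add_left {V₁ V₂ : Type*} [AddCommGroup V₁] [Module k V₁] [FiniteDimensional k V₁]
    [AddCommGroup V₂] [Module k V₂] [FiniteDimensional k V₂] {ρ₁ : Representation k G V₁}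
    {ρ₂ : Representation k G V₂} (h : ρ.character = ρ₁.character + ρ₂.character)
    (σ : Representation k G W) : homDim ρ σ = homDim ρ₁ σ + homDim ρ₂ σ := by
  rw [homDim_comm, homDim_add_right h, homDim_comm, homDim_comm ρ₂]

variable (ρ σ) in
theorem homDim_extendScalars (K : Type*) [Field K] [Algebra k K] :
    homDim (ρ.extendScalars K) (σ.extendScalars K) = homDim ρ σ := by
  have : CharZero K := charZero_of_injective_algebraMap (algebraMap k K).injective
  apply Nat.cast_injective (R := K)
  rw [homDim_eq_sum, ← map_natCast (algebraMap k K) (homDim ρ σ), homDim_eq_sum]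
  simp [character_extendScalars]

theorem homDim_congr_left {V' : Type*} [AddCommGroup V'] [Module k V'] [FiniteDimensional k V']
    {ρ' : Representation k G V'} (e : Equiv ρ ρ') (σ : Representation k G W) :
    homDim ρ σ = homDim ρ' σ := by
  apply Nat.cast_injective (R := k)
  rw [homDim_eq_sum, homDim_eq_sum, char_iso e]

/-- Two representations with a common irreducible constituent admit a nonzero equivariant map. -/
theorem homDim_ne_zero_of_common (hτ : τ.IsIrreducible) (h₁ : homDim τ ρ ≠ 0)
    (h₂ : homDim τ σ ≠ 0) : homDim ρ σ ≠ 0 := by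
  obtain ⟨f, hf⟩ := exists_injective_of_homDim_ne_zero hτ h₁
  obtain ⟨S, ⟨e⟩⟩ := exists_equiv_prod_of_injective f hf
  rw [homDim_add_left (character_eq_add e)]
  omega

theorem isIrreducible_of_homDim_self_eq_one (h : homDim ρ ρ = 1) : ρ.IsIrreducible := by
  have hV : Nontrivial V := by
    by_contra hV
    rw [not_nontrivial_iff_subsingleton] at hV
    obtain ⟨f, hf⟩ := (homDim_ne_zero_iff ρ ρ).1 (by omega)
    obtain ⟨v, hv⟩ := IntertwiningMap.exists_apply_ne_zero hf
    exact hv (Subsingleton.elim _ _)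
  obtain ⟨S, hS⟩ := exists_irreducible_subrepresentation (ρ := ρ)
  have := nontrivial_of_isIrreducible hS
  have hinj : Function.Injective S.subtype := Subtype.val_injective
  obtain ⟨T, ⟨e⟩⟩ := exists_equiv_prod_of_injective S.subtype hinj
  have hT : homDim T.toRepresentation T.toRepresentation = 0 := by
    have h1 := homDim_self_ne_zero S.toRepresentation
    rw [homDim_add_left (character_eq_add e), homDim_add_right (character_eq_add e),
      homDim_add_right (character_eq_add e)] at h
    omega
  have hT' : Module.finrank k T.toSubmodule = 0 := by
    by_contra hne
    have : Nontrivial T.toSubmodule := Module.nontrivial_of_finrank_pos (Nat.pos_of_ne_zero hne)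
    exact homDim_self_ne_zero T.toRepresentation hT
  have hfr := finrank_eq_add e
  rw [hT', add_zero] at hfr
  have hStop : S.toSubmodule = ⊤ := Submodule.eq_top_of_finrank_eq hfr.symm
  refine { toNontrivial := ⟨⊥, ⊤, ?_⟩, eq_bot_or_eq_top := ?_ }
  · intro h'
    have : (⊥ : Submodule k V) = ⊤ := congrArg Subrepresentation.toSubmodule h'
    exact bot_ne_top this
  · intro R
    let R' : Subrepresentation S.toRepresentation :=
      ⟨R.toSubmodule.comap S.toSubmodule.subtype, fun g v hv => R.apply_mem_toSubmodule g hv⟩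
    have hmem : ∀ v : V, v ∈ S.toSubmodule := fun v => by rw [hStop]; trivial
    rcases hS.eq_bot_or_eq_top R' with h' | h'
    · left
      have h'' : R'.toSubmodule = ⊥ := congrArg Subrepresentation.toSubmodule h'
      refine Subrepresentation.toSubmodule_injective ((Submodule.eq_bot_iff _).2 fun v hv => ?_)
      have : (⟨v, hmem v⟩ : S.toSubmodule) ∈ R'.toSubmodule := hv
      rw [h''] at this
      exact congrArg Subtype.val ((Submodule.mem_bot k).1 this)
    · right
      have h'' : R'.toSubmodule = ⊤ := congrArg Subrepresentation.toSubmodule h'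
      refine Subrepresentation.toSubmodule_injective (Submodule.eq_top_iff'.2 fun v => ?_)
      have : (⟨v, hmem v⟩ : S.toSubmodule) ∈ R'.toSubmodule := by rw [h'']; trivial
      exact this

end Finite

end Representation

/-! ### Invariant complex structures on real representations -/

/-- `det(J)² = (-1)^(dim V)` is not negative. -/
theorem even_finrank_of_sq_eq_neg {V : Type*} [AddCommGroup V] [Module ℝ V]
    [FiniteDimensional ℝ V] (J : V →ₗ[ℝ] V) (hJ : ∀ v, J (J v) = -v) :
    Even (Module.finrank ℝ V) := by
  by_contra hodd
  rw [Nat.not_even_iff_odd] at hodd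
  have h1 : J * J = (-1 : ℝ) • (1 : Module.End ℝ V) := by
    ext v
    simp [hJ]
  have h2 : LinearMap.det J * LinearMap.det J = (-1 : ℝ) ^ Module.finrank ℝ V := by
    rw [← map_mul, h1, LinearMap.det_smul, map_one, mul_one]
  rw [hodd.neg_one_pow] at h2
  nlinarith [mul_self_nonneg (LinearMap.det J)]

/-- A finite-dimensional real division algebra without a square root of `-1` is `ℝ`: the minimal
polynomial of an element is irreducible of degree at most two, and completing the square in a
quadratic one produces a square root of `-1`. -/
theorem finrank_eq_one_of_forall_sq_ne_neg_one {D : Type*} [DivisionRing D] [Algebra ℝ D]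
    [FiniteDimensional ℝ D] (h : ∀ x : D, x * x ≠ -1) : Module.finrank ℝ D = 1 := by
  rw [finrank_eq_one_iff_of_nonzero' 1 one_ne_zero]
  intro x
  have hint : IsIntegral ℝ x := Algebra.IsIntegral.isIntegral x
  have hirr := minpoly.irreducible hint
  have hmonic := minpoly.monic hint
  have hdeg : (minpoly ℝ x).natDegree ≤ 2 :=
    Polynomial.natDegree_le_of_degree_le hirr.degree_le_two
  have hpos : 0 < (minpoly ℝ x).natDegree := minpoly.natDegree_pos hint
  have hx := minpoly.aeval ℝ x
  interval_cases hn : (minpoly ℝ x).natDegree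
  · rw [hmonic.eq_X_add_C hn] at hx
    simp only [map_add, Polynomial.aeval_X, Polynomial.aeval_C] at hx
    refine ⟨-(minpoly ℝ x).coeff 0, ?_⟩
    rw [neg_smul, ← Algebra.algebraMap_eq_smul_one]
    exact (eq_neg_of_add_eq_zero_left hx).symm
  · set p := minpoly ℝ x with hp
    set b := p.coeff 1
    set c := p.coeff 0
    have hpe : p = Polynomial.X ^ 2 + Polynomial.C b * Polynomial.X + Polynomial.C c := by
      rw [p.as_sum_range_C_mul_X_pow, hn]
      have h2 : p.coeff 2 = 1 := by
        have := hmonic.coeff_natDegree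
        rwa [hn] at this
      simp [Finset.sum_range_succ, h2, b, c]
      ring
    have hsq : (x + algebraMap ℝ D (b / 2)) * (x + algebraMap ℝ D (b / 2)) =
        algebraMap ℝ D (b ^ 2 / 4 - c) := by
      rw [hpe] at hx
      simp only [map_add, map_mul, map_pow, Polynomial.aeval_X, Polynomial.aeval_C] at hx
      have hcomm := Algebra.commutes (b / 2) x
      have hb : algebraMap ℝ D b = algebraMap ℝ D (b / 2) + algebraMap ℝ D (b / 2) := by
        rw [← map_add, add_halves]
      have hb' : algebraMap ℝ D (b ^ 2 / 4 - c) =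
          algebraMap ℝ D (b / 2) * algebraMap ℝ D (b / 2) - algebraMap ℝ D c := by
        rw [← map_mul, ← map_sub]
        congr 1
        ring
      rw [hb, add_mul, pow_two] at hx
      rw [hb', add_mul, mul_add, mul_add, ← hcomm, eq_sub_iff_add_eq, ← sub_eq_zero, ← hx]
      abel
    rcases le_or_gt 0 (b ^ 2 / 4 - c) with h0 | h0
    · exfalso
      have hroot : p.IsRoot (-(b / 2) + √(b ^ 2 / 4 - c)) := by
        rw [Polynomial.IsRoot, hpe]
        have := Real.mul_self_sqrt h0
        simp only [Polynomial.eval_add, Polynomial.eval_pow, Polynomial.eval_X,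
          Polynomial.eval_mul, Polynomial.eval_C]
        nlinarith
      have h1 := Polynomial.degree_eq_one_of_irreducible_of_root hirr hroot
      have h2 : p.natDegree = 1 := Polynomial.natDegree_eq_of_degree_eq_some h1
      omega
    · exfalso
      set s := √(-(b ^ 2 / 4 - c)) with hs
      have hss : s * s = -(b ^ 2 / 4 - c) := Real.mul_self_sqrt (by linarith)
      have hs0 : s ≠ 0 := by
        intro h0'
        rw [h0'] at hss
        linarith
      refine h (s⁻¹ • (x + algebraMap ℝ D (b / 2))) ?_
      rw [smul_mul_smul_comm, hsq, Algebra.algebraMap_eq_smul_one, smul_smul, ← mul_inv, hss]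
      have : (-(b ^ 2 / 4 - c))⁻¹ * (b ^ 2 / 4 - c) = -1 := by
        rw [inv_neg, neg_mul, inv_mul_cancel₀ h0.ne]
      rw [this, neg_smul, one_smul]

namespace Representation

variable {G : Type*} [Group G]

/-- A real representation has an invariant complex structure if some equivariant endomorphism
squares to `-1`. -/
def HasComplexStructure {V : Type*} [AddCommGroup V] [Module ℝ V] (ρ : Representation ℝ G V) :
    Prop :=
  ∃ J : IntertwiningMap ρ ρ, ∀ v, J (J v) = -v

section

variable {V W U : Type*} [AddCommGroup V] [Module ℝ V] [AddCommGroup W] [Module ℝ W]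
  [AddCommGroup U] [Module ℝ U]
  {ρ : Representation ℝ G V} {σ : Representation ℝ G W} {τ : Representation ℝ G U}

theorem HasComplexStructure.of_equiv (h : HasComplexStructure ρ) (e : Equiv ρ σ) :
    HasComplexStructure σ := by
  obtain ⟨J, hJ⟩ := h
  refine ⟨(e.toIntertwiningMap.comp J).comp e.symm.toIntertwiningMap, fun v => ?_⟩
  change e (J (e.symm (e (J (e.symm v))))) = -v
  rw [Equiv.symm_apply_apply, hJ, map_neg, Equiv.apply_symm_apply]

theorem HasComplexStructure.prod (h₁ : HasComplexStructure ρ) (h₂ : HasComplexStructure σ) :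
    HasComplexStructure (ρ.prod σ) := by
  obtain ⟨J, hJ⟩ := h₁
  obtain ⟨K, hK⟩ := h₂
  refine ⟨⟨J.toLinearMap.prodMap K.toLinearMap, fun g => ?_⟩, fun v => ?_⟩
  · refine LinearMap.ext fun v => Prod.ext ?_ ?_
    · exact IntertwiningMap.isIntertwining _ _ J g v.1
    · exact IntertwiningMap.isIntertwining _ _ K g v.2
  · exact Prod.ext (hJ v.1) (hK v.2)

theorem hasComplexStructure_prod_self (ρ : Representation ℝ G V) :
    HasComplexStructure (ρ.prod ρ) := by
  refine ⟨⟨(-LinearMap.snd ℝ V V).prod (LinearMap.fst ℝ V V), fun g => ?_⟩, fun v => ?_⟩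
  · refine LinearMap.ext fun v => Prod.ext ?_ ?_
    · exact (map_neg (ρ g) v.2).symm
    · rfl
  · rfl

end

section Finite

variable {V W U : Type*} [AddCommGroup V] [Module ℝ V] [FiniteDimensional ℝ V]
  [AddCommGroup W] [Module ℝ W] [FiniteDimensional ℝ W]
  [AddCommGroup U] [Module ℝ U] [FiniteDimensional ℝ U]
  {ρ : Representation ℝ G V} {σ : Representation ℝ G W} {τ : Representation ℝ G U}

/-- A complex structure on `V` makes the space of equivariant maps into `V` complex. -/
theorem HasComplexStructure.even_homDim (h : HasComplexStructure ρ) (σ : Representation ℝ G W) :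
    Even (homDim σ ρ) := by
  obtain ⟨J, hJ⟩ := h
  refine even_finrank_of_sq_eq_neg (IntertwiningMap.llcomp σ ρ ρ J) fun f => ?_
  ext v
  exact hJ (f v)

/-- The equivariant endomorphisms form a real division algebra in which `-1` has no square root. -/
theorem homDim_self_eq_one (hρ : ρ.IsIrreducible) (h : ¬ HasComplexStructure ρ) :
    homDim ρ ρ = 1 := by
  classical
  have := hρ
  let e := IntertwiningMap.equivAlgEnd (ρ := ρ)
  have : FiniteDimensional ℝ (Module.End (MonoidAlgebra ℝ G) ρ.asModule) :=
    Module.Finite.equiv e.toLinearEquiv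
  rw [homDim, e.toLinearEquiv.finrank_eq]
  refine finrank_eq_one_of_forall_sq_ne_neg_one fun x hx => h ⟨e.symm x, fun v => ?_⟩
  have h1 : e.symm x * e.symm x = e.symm (-1) := by rw [← map_mul, hx]
  have h2 : e.symm (-1) = -1 := by
    apply e.injective
    rw [e.apply_symm_apply]
    exact ((e.toLinearEquiv.map_neg 1).trans (congrArg Neg.neg (map_one e))).symm
  rw [h2] at h1
  exact congrArg (fun f : IntertwiningMap ρ ρ => f v) h1

end Finite

/-- A real representation has an invariant complex structure as soon as the irreducible
representations `τ` without one occur in it with even multiplicity. Two copies of such a `τ` carry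
the complex structure `(x, y) ↦ (-y, x)`, and they can be split off one pair at a time. -/
theorem hasComplexStructure_of_even [Fintype G] {V : Type u} [AddCommGroup V] [Module ℝ V]
    [FiniteDimensional ℝ V] {ρ : Representation ℝ G V}
    (h : ∀ (W : Type u) [AddCommGroup W] [Module ℝ W] [FiniteDimensional ℝ W]
      (τ : Representation ℝ G W), τ.IsIrreducible → ¬ HasComplexStructure τ → Even (homDim τ ρ)) :
    HasComplexStructure ρ := by
  obtain ⟨n, hn⟩ : ∃ n, Module.finrank ℝ V = n := ⟨_, rfl⟩
  induction n using Nat.strong_induction_on generalizing V with | _ n ih =>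
  rcases subsingleton_or_nontrivial V with hV | hV
  · exact ⟨0, fun v => Subsingleton.elim _ _⟩
  obtain ⟨S, hS⟩ := exists_irreducible_subrepresentation (ρ := ρ)
  have := nontrivial_of_isIrreducible hS
  have hSpos : 0 < Module.finrank ℝ S.toSubmodule := Module.finrank_pos
  obtain ⟨T, ⟨e⟩⟩ := exists_equiv_prod_of_injective S.subtype Subtype.val_injective
  have hdim := finrank_eq_add e
  by_cases hcs : HasComplexStructure S.toRepresentation
  · refine (hcs.prod (ih (Module.finrank ℝ T.toSubmodule) (by omega) ?_ rfl)).of_equiv e.symm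
    intro W _ _ _ τ hτ hτ'
    have h1 := h W τ hτ hτ'
    rw [homDim_add_right (character_eq_add e)] at h1
    have h2 : homDim τ S.toRepresentation = 0 := by
      by_contra hne
      obtain ⟨f⟩ := nonempty_equiv_of_homDim_ne_zero hτ hS hne
      exact hτ' (hcs.of_equiv f.symm)
    rwa [h2, zero_add] at h1
  · have h1 := h S.toSubmodule S.toRepresentation hS hcs
    rw [homDim_add_right (character_eq_add e), homDim_self_eq_one hS hcs] at h1
    have h2 : homDim S.toRepresentation T.toRepresentation ≠ 0 := by
      intro h0
      rw [h0] at h1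
      exact Nat.not_even_one h1
    obtain ⟨f, hf⟩ := exists_injective_of_homDim_ne_zero hS h2
    obtain ⟨R, ⟨e'⟩⟩ := exists_equiv_prod_of_injective f hf
    have hdim' := finrank_eq_add e'
    have hR : HasComplexStructure R.toRepresentation := by
      refine ih (Module.finrank ℝ R.toSubmodule) (by omega) ?_ rfl
      intro W _ _ _ τ hτ hτ'
      have h3 := h W τ hτ hτ'
      rw [homDim_add_right (character_eq_add e), homDim_add_right (character_eq_add e'),
        ← add_assoc, Nat.even_add] at h3
      exact h3.1 ⟨_, rfl⟩
    have hsplit : Equiv ((S.toRepresentation.prod S.toRepresentation).prod R.toRepresentation)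
        (S.toRepresentation.prod (S.toRepresentation.prod R.toRepresentation)) :=
      Equiv.mk (LinearEquiv.prodAssoc ℝ _ _ _) fun g => rfl
    have hsplit' : Equiv (S.toRepresentation.prod T.toRepresentation)
        (S.toRepresentation.prod (S.toRepresentation.prod R.toRepresentation)) :=
      Equiv.mk ((LinearEquiv.refl ℝ _).prodCongr e'.toLinearEquiv) fun g => by
        refine LinearMap.ext fun v => Prod.ext rfl ?_
        exact IntertwiningMap.isIntertwining _ _ e'.toIntertwiningMap g v.2
    exact ((((hasComplexStructure_prod_self S.toRepresentation).prod hR).of_equiv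
      hsplit).of_equiv hsplit'.symm).of_equiv e.symm

/-- Cancellation of a summand with a complex structure. By `hasComplexStructure_of_even` only
parities of multiplicities matter, so the decomposition is needed only at the level of
characters. -/
theorem HasComplexStructure.cancel [Fintype G] {V : Type u} {W U : Type*}
    [AddCommGroup V] [Module ℝ V] [FiniteDimensional ℝ V]
    [AddCommGroup W] [Module ℝ W] [FiniteDimensional ℝ W]
    [AddCommGroup U] [Module ℝ U] [FiniteDimensional ℝ U]
    {ρ : Representation ℝ G V} {σ : Representation ℝ G W} {τ : Representation ℝ G U}
    (h : HasComplexStructure σ) (hτ : HasComplexStructure τ)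
    (hchar : σ.character = ρ.character + τ.character) : HasComplexStructure ρ := by
  refine hasComplexStructure_of_even fun T _ _ _ π _ _ => ?_
  have h1 := h.even_homDim π
  rw [homDim_add_right hchar, Nat.even_add] at h1
  exact h1.2 (hτ.even_homDim π)

end Representation

/-! ### Unitarizability and the Frobenius–Schur indicator -/

namespace Representation

section Unitary

variable {G V : Type*} [Group G] [Fintype G] [AddCommGroup V] [Module ℂ V]
  [FiniteDimensional ℂ V]

/-- A complex representation of a finite group is unitary in suitable coordinates: the map
`v ↦ (ρ g v)_g` embeds `V` into a Hilbert space whose coordinates the group permutes. -/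
theorem exists_unitary_coordinates (ρ : Representation ℂ G V) :
    ∃ Φ : V ≃ₗ[ℂ] EuclideanSpace ℂ (Fin (Module.finrank ℂ V)), ∀ g v, ‖Φ (ρ g v)‖ = ‖Φ v‖ := by
  let E := EuclideanSpace ℂ (Fin (Module.finrank ℂ V))
  let e : V ≃ₗ[ℂ] E := LinearEquiv.ofFinrankEq V E (by simp [E])
  let ι : V →ₗ[ℂ] PiLp 2 (fun _ : G => E) :=
    (WithLp.linearEquiv 2 ℂ (G → E)).symm.toLinearMap ∘ₗ
      LinearMap.pi fun g => e.toLinearMap ∘ₗ ρ g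
  have hι : ∀ v g, ι v g = e (ρ g v) := fun _ _ => rfl
  have hinj : Function.Injective ι := by
    intro v w h
    have h1 := congrArg (fun x : PiLp 2 (fun _ : G => E) => x 1) h
    simp only [hι, map_one, Module.End.one_apply] at h1
    exact e.injective h1
  have hnorm : ∀ g v, ‖ι (ρ g v)‖ = ‖ι v‖ := by
    intro g v
    rw [← sq_eq_sq₀ (norm_nonneg _) (norm_nonneg _), PiLp.norm_sq_eq_of_L2,
      PiLp.norm_sq_eq_of_L2, ← Equiv.sum_comp (Equiv.mulRight g) fun h => ‖(ι v).ofLp h‖ ^ 2]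
    refine Finset.sum_congr rfl fun h _ => ?_
    change ‖e (ρ h (ρ g v))‖ ^ 2 = ‖e (ρ (h * g) v)‖ ^ 2
    rw [map_mul, Module.End.mul_apply]
  have hfr : Module.finrank ℂ (LinearMap.range ι) = Module.finrank ℂ V :=
    LinearMap.finrank_range_of_inj hinj
  let b := (stdOrthonormalBasis ℂ (LinearMap.range ι)).reindex (finCongr hfr)
  refine ⟨(LinearEquiv.ofInjective ι hinj).trans b.repr.toLinearEquiv, fun g v => ?_⟩
  change ‖b.repr (LinearEquiv.ofInjective ι hinj (ρ g v))‖ =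
    ‖b.repr (LinearEquiv.ofInjective ι hinj v)‖
  rw [LinearIsometryEquiv.norm_map, LinearIsometryEquiv.norm_map]
  exact hnorm g v

theorem character_inv_eq_conj (ρ : Representation ℂ G V) (g : G) :
    ρ.character g⁻¹ = (starRingEnd ℂ) (ρ.character g) := by
  obtain ⟨Φ, hΦ⟩ := ρ.exists_unitary_coordinates
  let b := EuclideanSpace.basisFun (Fin (Module.finrank ℂ V)) ℂ
  let U : G → (EuclideanSpace ℂ (Fin (Module.finrank ℂ V)) →ₗᵢ[ℂ]
      EuclideanSpace ℂ (Fin (Module.finrank ℂ V))) := fun g =>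
    ⟨Φ.conj (ρ g), fun x => by
      rw [LinearEquiv.conj_apply_apply, hΦ, LinearEquiv.apply_symm_apply]⟩
  have hU : ∀ h x, U h x = Φ (ρ h (Φ.symm x)) := fun _ _ => rfl
  have htr : ∀ h, ρ.character h = ∑ i, inner ℂ (b i) (U h (b i)) := fun h => by
    rw [character, ← LinearMap.trace_conj' (ρ h) Φ, LinearMap.trace_eq_sum_inner _ b]
    rfl
  rw [htr, htr, map_sum]
  refine Finset.sum_congr rfl fun i _ => ?_
  rw [inner_conj_symm, ← (U g).inner_map_map]
  congr 1
  rw [hU, hU, Φ.symm_apply_apply, ← Module.End.mul_apply, ← map_mul, mul_inv_cancel, map_one,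
    Module.End.one_apply, Φ.apply_symm_apply]

theorem charInner_character {W : Type*} [AddCommGroup W] [Module ℂ W] [FiniteDimensional ℂ W]
    (ρ : Representation ℂ G V) (σ : Representation ℂ G W) :
    charInner σ.character ρ.character = homDim ρ σ := by
  rw [homDim_eq_sum, charInner, Nat.card_eq_fintype_card]
  simp_rw [character_inv_eq_conj]

theorem character_mem_irr {ρ : Representation ℂ G V} (h : ρ.IsIrreducible) :
    ρ.character ∈ Irr G := by
  let b := (Module.finBasis ℂ V).equivFun
  let σ : Representation ℂ G (Fin (Module.finrank ℂ V) → ℂ) :=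
    (b.conjRingEquiv : Module.End ℂ V →* _).comp ρ
  let e : Equiv ρ σ := Equiv.mk b fun g => by
    refine LinearMap.ext fun v => ?_
    change b (ρ g v) = b (ρ g (b.symm (b v)))
    rw [b.symm_apply_apply]
  refine ⟨_, σ, isIrreducible_of_homDim_self_eq_one ?_, (char_iso e).symm⟩
  rw [← homDim_congr_left e, homDim_comm, ← homDim_congr_left e]
  have := h
  exact IsIrreducible.finrank_intertwiningMap_self ρ

end Unitary

section FrobeniusSchur

variable {G V ι : Type*} [Group G] [Fintype G] [AddCommGroup V] [Module ℂ V]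
  [FiniteDimensional ℂ V] [Fintype ι] [DecidableEq ι] (ρ : Representation ℂ G V)
  (b : Module.Basis ι ℂ V)

open Matrix

/-- The matrices `X` of the `G`-invariant bilinear forms on `V`. -/
def IsInvariantForm (X : Matrix ι ι ℂ) : Prop :=
  ∀ g, (LinearMap.toMatrix b b (ρ g))ᵀ * X * LinearMap.toMatrix b b (ρ g) = X

variable {ρ b}

theorem toMatrix_mul_inv (g : G) :
    LinearMap.toMatrix b b (ρ g) * LinearMap.toMatrix b b (ρ g⁻¹) = 1 := by
  rw [← LinearMap.toMatrix_mul, ← map_mul, mul_inv_cancel, map_one, LinearMap.toMatrix_one]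

theorem IsInvariantForm.mul_eq {X : Matrix ι ι ℂ} (hX : IsInvariantForm ρ b X) (g : G) :
    X * LinearMap.toMatrix b b (ρ g) = (LinearMap.toMatrix b b (ρ g⁻¹))ᵀ * X := by
  conv_rhs => rw [← hX g]
  rw [← Matrix.mul_assoc, ← Matrix.mul_assoc, ← Matrix.transpose_mul, toMatrix_mul_inv,
    Matrix.transpose_one, Matrix.one_mul]

/-- An invariant form on an irreducible representation is nondegenerate, since its kernel is a
subrepresentation. -/
theorem IsInvariantForm.isUnit (hρ : ρ.IsIrreducible) {X : Matrix ι ι ℂ}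
    (hX : IsInvariantForm ρ b X) (h0 : X ≠ 0) : IsUnit X := by
  rw [← Matrix.mulVec_injective_iff_isUnit]
  let S : Subrepresentation ρ :=
    ⟨LinearMap.ker (X.mulVecLin ∘ₗ b.equivFun.toLinearMap), by
      intro g v hv
      rw [LinearMap.mem_ker] at hv ⊢
      change X *ᵥ (b.repr v) = 0 at hv
      change X *ᵥ (b.repr (ρ g v)) = 0
      rw [← LinearMap.toMatrix_mulVec_repr b b, Matrix.mulVec_mulVec, hX.mul_eq,
        ← Matrix.mulVec_mulVec, hv, Matrix.mulVec_zero]⟩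
  rcases hρ.eq_bot_or_eq_top S with h | h
  · have h' : LinearMap.ker (X.mulVecLin ∘ₗ b.equivFun.toLinearMap) = ⊥ :=
      congrArg Subrepresentation.toSubmodule h
    rw [LinearMap.ker_eq_bot] at h'
    intro x y hxy
    apply b.equivFun.symm.injective
    apply h'
    change X *ᵥ b.equivFun (b.equivFun.symm x) = X *ᵥ b.equivFun (b.equivFun.symm y)
    rwa [LinearEquiv.apply_symm_apply, LinearEquiv.apply_symm_apply]
  · exfalso
    have h' : LinearMap.ker (X.mulVecLin ∘ₗ b.equivFun.toLinearMap) = ⊤ :=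
      congrArg Subrepresentation.toSubmodule h
    rw [LinearMap.ker_eq_top] at h'
    refine h0 (Matrix.ext_of_mulVec_single fun i => ?_)
    have h1 : X *ᵥ b.repr (b i) = 0 := congrArg (fun f => f (b i)) h'
    rw [Module.Basis.repr_self, Finsupp.single_eq_pi_single] at h1
    rw [h1, Matrix.zero_mulVec]

/-- Schur's lemma for bilinear forms. -/
theorem IsInvariantForm.exists_smul (hρ : ρ.IsIrreducible) {X Y : Matrix ι ι ℂ}
    (hX : IsInvariantForm ρ b X) (h0 : X ≠ 0) (hY : IsInvariantForm ρ b Y) :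
    ∃ c : ℂ, Y = c • X := by
  have hu := hX.isUnit hρ h0
  have hdet : IsUnit X.det := (Matrix.isUnit_iff_isUnit_det X).1 hu
  let Z := X⁻¹ * Y
  have hXZ : X * Z = Y := by
    rw [← Matrix.mul_assoc, Matrix.mul_nonsing_inv _ hdet, Matrix.one_mul]
  have hcomm : ∀ g, Z * LinearMap.toMatrix b b (ρ g) = LinearMap.toMatrix b b (ρ g) * Z := by
    intro g
    apply hu.mul_left_cancel
    rw [← Matrix.mul_assoc, hXZ, hY.mul_eq, ← Matrix.mul_assoc, hX.mul_eq, Matrix.mul_assoc, hXZ]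
  let f : IntertwiningMap ρ ρ := ⟨Matrix.toLin b b Z, fun g => by
    apply (LinearMap.toMatrix b b).injective
    rw [LinearMap.toMatrix_comp b b b, LinearMap.toMatrix_comp b b b, LinearMap.toMatrix_toLin]
    exact hcomm g⟩
  have := hρ
  obtain ⟨c, hc⟩ := (IsIrreducible.algebraMap_intertwiningMap_bijective_of_isAlgClosed).2 f
  refine ⟨c, ?_⟩
  have h1 : Matrix.toLin b b Z = c • (1 : Module.End ℂ V) :=
    (congrArg IntertwiningMap.toLinearMap hc).symm
  have h2 := congrArg (LinearMap.toMatrix b b) h1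
  rw [LinearMap.toMatrix_toLin, map_smul, LinearMap.toMatrix_one] at h2
  rw [← hXZ, h2, Matrix.mul_smul, Matrix.mul_one]

variable (ρ b) in
/-- The average of the translates of a bilinear form. -/
noncomputable def averageForm : Matrix ι ι ℂ →ₗ[ℂ] Matrix ι ι ℂ where
  toFun X := (Fintype.card G : ℂ)⁻¹ •
    ∑ g, (LinearMap.toMatrix b b (ρ g))ᵀ * X * LinearMap.toMatrix b b (ρ g)
  map_add' X Y := by
    rw [← smul_add, ← Finset.sum_add_distrib]
    simp only [Matrix.mul_add, Matrix.add_mul]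
  map_smul' c X := by
    simp only [Matrix.mul_smul, Matrix.smul_mul, ← Finset.smul_sum]
    rw [RingHom.id_apply, smul_comm c]

theorem averageForm_apply (X : Matrix ι ι ℂ) :
    averageForm ρ b X = (Fintype.card G : ℂ)⁻¹ •
      ∑ g, (LinearMap.toMatrix b b (ρ g))ᵀ * X * LinearMap.toMatrix b b (ρ g) := rfl

theorem isInvariantForm_averageForm (X : Matrix ι ι ℂ) :
    IsInvariantForm ρ b (averageForm ρ b X) := by
  intro h
  rw [averageForm_apply, Matrix.mul_smul, Matrix.smul_mul, Finset.mul_sum, Finset.sum_mul]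
  refine congrArg (fun Y => (Fintype.card G : ℂ)⁻¹ • Y)
    (Fintype.sum_equiv (Equiv.mulRight h) _ _ fun g => ?_)
  rw [Equiv.coe_mulRight, map_mul, LinearMap.toMatrix_mul, Matrix.transpose_mul]
  simp only [Matrix.mul_assoc]

theorem IsInvariantForm.averageForm_eq {X : Matrix ι ι ℂ} (hX : IsInvariantForm ρ b X) :
    averageForm ρ b X = X := by
  rw [averageForm_apply, Finset.sum_congr rfl fun g _ => hX g, Finset.sum_const,
    Finset.card_univ, ← Nat.cast_smul_eq_nsmul ℂ, smul_smul,
    inv_mul_cancel₀ (Nat.cast_ne_zero.2 Fintype.card_ne_zero), one_smul]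

/-- The indicator is the trace of `X ↦ P(Xᵀ)`, where `P` averages bilinear forms over the group. -/
theorem frobeniusSchur_eq_sum :
    frobeniusSchur ρ.character = ∑ i, ∑ j, averageForm ρ b (Matrix.single j i 1) i j := by
  have h : ∀ g, ρ.character (g ^ 2) = ∑ i, ∑ j,
      ((LinearMap.toMatrix b b (ρ g))ᵀ * Matrix.single j i 1 *
        LinearMap.toMatrix b b (ρ g) : Matrix ι ι ℂ) i j := by
    intro g
    rw [character, LinearMap.trace_eq_matrix_trace ℂ b, pow_two, map_mul, LinearMap.toMatrix_mul,
      Matrix.trace]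
    refine Finset.sum_congr rfl fun i _ => ?_
    rw [Matrix.diag_apply, Matrix.mul_apply]
    refine Finset.sum_congr rfl fun j _ => ?_
    simp [Matrix.mul_apply, Matrix.single_apply, ite_and, mul_comm, Finset.sum_ite_eq]
  rw [frobeniusSchur, Finset.sum_congr rfl fun g _ => h g, Finset.sum_comm, Finset.mul_sum]
  refine Finset.sum_congr rfl fun i _ => ?_
  rw [Finset.sum_comm, Finset.mul_sum]
  refine Finset.sum_congr rfl fun j _ => ?_
  rw [averageForm_apply, Matrix.smul_apply, Matrix.sum_apply, smul_eq_mul]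

/-- If an invariant form is symmetric (`ε = 1`) or alternating (`ε = -1`), the Frobenius–Schur
indicator is `ε`. It is `∑ P(E_ji)_ij` for the projection `P` onto the invariant forms, and all
`P(E_ji)` are multiples of `X`. -/
theorem IsInvariantForm.frobeniusSchur_eq (hρ : ρ.IsIrreducible) {X : Matrix ι ι ℂ}
    (hX : IsInvariantForm ρ b X) (h0 : X ≠ 0) {ε : ℂ} (hε : Xᵀ = ε • X) :
    frobeniusSchur ρ.character = ε := by
  refine smul_left_injective ℂ h0 ?_
  change frobeniusSchur ρ.character • X = ε • X
  have h1 : ∀ i j, averageForm ρ b (Matrix.single j i 1) i j • X =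
      averageForm ρ b (Matrix.single j i (X i j)) := by
    intro i j
    obtain ⟨c, hc⟩ := hX.exists_smul hρ h0 (isInvariantForm_averageForm (Matrix.single j i 1))
    have h2 : Matrix.single j i (X i j) = X i j • Matrix.single j i (1 : ℂ) := by
      rw [Matrix.smul_single, smul_eq_mul, mul_one]
    rw [h2, map_smul, hc, Matrix.smul_apply, smul_smul, smul_eq_mul, mul_comm]
  rw [frobeniusSchur_eq_sum (b := b), Finset.sum_smul]
  simp only [Finset.sum_smul, h1]
  have h3 : Xᵀ = ∑ i, ∑ j, Matrix.single j i (X i j) := by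
    rw [Finset.sum_comm]
    exact Matrix.matrix_eq_sum_single Xᵀ
  simp only [← map_sum]
  rw [← h3, hε, map_smul, hX.averageForm_eq]

theorem frobeniusSchur_mem (hρ : ρ.IsIrreducible) :
    frobeniusSchur ρ.character = 0 ∨ frobeniusSchur ρ.character = 1 ∨
      frobeniusSchur ρ.character = -1 := by
  classical
  let b := Module.finBasis ℂ V
  by_cases hex : ∃ X, IsInvariantForm ρ b X ∧ X ≠ 0
  · right
    obtain ⟨X, hX, h0⟩ := hex
    have hXt : IsInvariantForm ρ b Xᵀ := fun g => by
      conv_rhs => rw [← hX g]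
      simp only [Matrix.transpose_mul, Matrix.transpose_transpose, Matrix.mul_assoc]
    obtain ⟨ε, hε⟩ := hX.exists_smul hρ h0 hXt
    have hsq : ε * ε = 1 := by
      refine smul_left_injective ℂ h0 ?_
      change (ε * ε) • X = (1 : ℂ) • X
      rw [mul_smul, ← hε, one_smul, ← Matrix.transpose_smul, ← hε, Matrix.transpose_transpose]
    rw [hX.frobeniusSchur_eq hρ h0 hε]
    exact mul_self_eq_one_iff.1 hsq
  · -- Without invariant forms the averaging operator vanishes.
    left
    push Not at hex
    rw [frobeniusSchur_eq_sum (b := b)]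
    simp [hex _ (isInvariantForm_averageForm _)]

end FrobeniusSchur

end Representation

/-! ### Rational representations and their complex constituents -/

namespace Representation

section General

variable {k G V W U : Type*} [Field k] [Group G]
  [AddCommGroup V] [Module k V] [FiniteDimensional k V]
  [AddCommGroup W] [Module k W] [FiniteDimensional k W]
  [AddCommGroup U] [Module k U] [FiniteDimensional k U]
  {ρ : Representation k G V} {σ : Representation k G W} {τ : Representation k G U}

theorem isIrreducible_of_equiv (e : Equiv ρ σ) (h : ρ.IsIrreducible) : σ.IsIrreducible := by
  have := nontrivial_of_isIrreducible h
  have hW : Nontrivial W := e.toLinearEquiv.symm.toEquiv.nontrivial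
  refine { toNontrivial := ⟨⊥, ⊤, ?_⟩, eq_bot_or_eq_top := fun S => ?_ }
  · intro h'
    have : (⊥ : Submodule k W) = ⊤ := congrArg Subrepresentation.toSubmodule h'
    exact bot_ne_top this
  · let R : Subrepresentation ρ := ⟨S.toSubmodule.comap e.toLinearEquiv.toLinearMap, by
      intro g v hv
      have h1 : e (ρ g v) = σ g (e v) := IntertwiningMap.isIntertwining _ _ e.toIntertwiningMap g v
      change e (ρ g v) ∈ S.toSubmodule
      rw [h1]
      exact S.apply_mem_toSubmodule g hv⟩
    have hinj := Submodule.comap_injective_of_surjective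
      (f := e.toLinearEquiv.toLinearMap) e.toLinearEquiv.surjective
    rcases h.eq_bot_or_eq_top R with h' | h'
    · left
      have h'' : R.toSubmodule = ⊥ := congrArg Subrepresentation.toSubmodule h'
      refine Subrepresentation.toSubmodule_injective (hinj ?_)
      exact h''.trans (LinearMap.ker_eq_bot.2 e.toLinearEquiv.injective).symm
    · right
      have h'' : R.toSubmodule = ⊤ := congrArg Subrepresentation.toSubmodule h'
      exact Subrepresentation.toSubmodule_injective (hinj h'')

variable (ρ) in
theorem exists_equiv_fin :
    ∃ σ : Representation k G (Fin (Module.finrank k V) → k), Nonempty (Equiv ρ σ) := by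
  let b := (Module.finBasis k V).equivFun
  refine ⟨(b.conjRingEquiv : Module.End k V →* _).comp ρ, ⟨Equiv.mk b fun g => ?_⟩⟩
  refine LinearMap.ext fun v => ?_
  change b (ρ g v) = b (ρ g (b.symm (b v)))
  rw [b.symm_apply_apply]

theorem homDim_congr_right [Fintype G] [CharZero k] (h : ρ.character = σ.character)
    (τ : Representation k G U) : homDim τ ρ = homDim τ σ := by
  apply Nat.cast_injective (R := k)
  rw [homDim_eq_sum, homDim_eq_sum, h]

variable [Fintype G]

variable (ρ) in
/-- The action of the central element `|G|⁻¹ ∑ g²` of the group algebra. -/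
noncomputable def squareAverage : IntertwiningMap ρ ρ where
  toLinearMap := (Fintype.card G : k)⁻¹ • ∑ g : G, ρ (g ^ 2)
  isIntertwining' h := by
    rw [LinearMap.smul_comp, LinearMap.comp_smul]
    congr 1
    change (∑ g : G, ρ (g ^ 2)) * ρ h = ρ h * ∑ g : G, ρ (g ^ 2)
    rw [Finset.sum_mul, Finset.mul_sum]
    refine Fintype.sum_equiv (MulAut.conj h⁻¹).toEquiv _ _ fun g => ?_
    rw [← map_mul, ← map_mul]
    congr 1
    simp [pow_two, mul_assoc]

variable (ρ) in
theorem squareAverage_apply (v : V) :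
    squareAverage ρ v = (Fintype.card G : k)⁻¹ • ∑ g : G, ρ (g ^ 2) v := by
  change ((Fintype.card G : k)⁻¹ • ∑ g : G, ρ (g ^ 2)) v = _
  rw [LinearMap.smul_apply, LinearMap.sum_apply]

theorem map_squareAverage (f : IntertwiningMap ρ σ) (v : V) :
    f (squareAverage ρ v) = squareAverage σ (f v) := by
  rw [squareAverage_apply, squareAverage_apply, map_smul, map_sum]
  simp only [IntertwiningMap.isIntertwining]

theorem squareAverage_extendScalars (K : Type*) [Field K] [Algebra k K] (x : K ⊗[k] V) :
    squareAverage (ρ.extendScalars K) x = (squareAverage ρ).toLinearMap.baseChange K x := by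
  induction x using TensorProduct.induction_on with
  | zero => rw [map_zero, map_zero]
  | add x y hx hy => rw [map_add, map_add, hx, hy]
  | tmul a v =>
    rw [LinearMap.baseChange_tmul, squareAverage_apply, IntertwiningMap.toLinearMap_apply,
      squareAverage_apply]
    simp only [extendScalars_apply, LinearMap.baseChange_tmul]
    rw [← TensorProduct.tmul_sum, TensorProduct.tmul_smul,
      ← algebraMap_smul K (Fintype.card G : k)⁻¹, map_inv₀, map_natCast]

end General

section Complex

variable {G V W : Type*} [Group G] [Fintype G] [AddCommGroup V] [Module ℂ V]
  [FiniteDimensional ℂ V] [AddCommGroup W] [Module ℂ W] [FiniteDimensional ℂ W]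
  {ρ : Representation ℂ G V} {σ : Representation ℂ G W}

theorem squareAverage_eq_smul (hρ : ρ.IsIrreducible) (v : V) :
    squareAverage ρ v =
      (frobeniusSchur ρ.character / (Module.finrank ℂ V : ℂ)) • v := by
  have := hρ
  have := nontrivial_of_isIrreducible hρ
  obtain ⟨c, hc⟩ :=
    (IsIrreducible.algebraMap_intertwiningMap_bijective_of_isAlgClosed).2 (squareAverage ρ)
  have h1 : (squareAverage ρ).toLinearMap = c • (1 : Module.End ℂ V) :=
    (congrArg IntertwiningMap.toLinearMap hc).symm
  have h2 : LinearMap.trace ℂ V (squareAverage ρ).toLinearMap =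
      frobeniusSchur ρ.character := by
    change LinearMap.trace ℂ V ((Fintype.card G : ℂ)⁻¹ • ∑ g : G, ρ (g ^ 2)) = _
    rw [map_smul, map_sum]
    rfl
  rw [h1, map_smul, LinearMap.trace_one, smul_eq_mul] at h2
  have h3 : (Module.finrank ℂ V : ℂ) ≠ 0 := Nat.cast_ne_zero.2 Module.finrank_pos.ne'
  rw [← h2, mul_div_cancel_right₀ _ h3]
  exact congrArg (fun f : Module.End ℂ V => f v) h1

theorem charInner_irr (hρ : ρ.IsIrreducible) {χ : G → ℂ} (hχ : χ ∈ Irr G)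
    [Decidable (ρ.character = χ)] :
    charInner ρ.character χ = if ρ.character = χ then 1 else 0 := by
  obtain ⟨d, τ, hτ, rfl⟩ := hχ
  split_ifs with h
  · have := hτ
    rw [h, charInner_character, homDim, IsIrreducible.finrank_intertwiningMap_self, Nat.cast_one]
  · rw [charInner_character, Nat.cast_eq_zero]
    by_contra hne
    obtain ⟨e⟩ := nonempty_equiv_of_homDim_ne_zero hτ hρ hne
    exact h (char_iso e).symm

theorem charInner_add_left (φ ψ χ : G → ℂ) :
    charInner (φ + ψ) χ = charInner φ χ + charInner ψ χ := by
  rw [charInner, charInner, charInner, ← mul_add, ← Finset.sum_add_distrib]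
  simp [add_mul]

/-- A character is the sum of its irreducible constituents, counted with multiplicity. -/
theorem character_eq_sum_irr (ρ : Representation ℂ G V) (g : G) :
    ρ.character g = ∑ χ ∈ (irr_finite G).toFinset, charInner ρ.character χ * χ g := by
  classical
  obtain ⟨n, hn⟩ : ∃ n, Module.finrank ℂ V = n := ⟨_, rfl⟩
  induction n using Nat.strong_induction_on generalizing V with | _ n ih =>
  rcases subsingleton_or_nontrivial V with hV | hV
  · have h0 : ρ.character = 0 := by
      funext h
      rw [character, Subsingleton.elim (ρ h) 0, map_zero]
      rfl
    simp [h0, charInner]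
  obtain ⟨S, hS⟩ := exists_irreducible_subrepresentation (ρ := ρ)
  have := nontrivial_of_isIrreducible hS
  have hSpos : 0 < Module.finrank ℂ S.toSubmodule := Module.finrank_pos
  obtain ⟨T, ⟨e⟩⟩ := exists_equiv_prod_of_injective S.subtype Subtype.val_injective
  have hdim := finrank_eq_add e
  have hT := ih (Module.finrank ℂ T.toSubmodule) (by omega) T.toRepresentation rfl
  rw [character_eq_add e, Pi.add_apply, hT]
  simp only [charInner_add_left, add_mul, Finset.sum_add_distrib]
  congr 1
  rw [Finset.sum_eq_single S.toRepresentation.character]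
  · rw [charInner_irr hS (character_mem_irr hS), if_pos rfl, one_mul]
  · intro χ hχ hne
    rw [charInner_irr hS ((irr_finite G).mem_toFinset.1 hχ), if_neg hne.symm, zero_mul]
  · intro h
    exact absurd ((irr_finite G).mem_toFinset.2 (character_mem_irr hS)) h

end Complex

section Rational

variable {G : Type*} [Group G] [Fintype G]
variable {V W : Type*} [AddCommGroup V] [Module ℚ V] [FiniteDimensional ℚ V]
  [AddCommGroup W] [Module ℚ W] [FiniteDimensional ℚ W]
  {ρ : Representation ℚ G V} {σ : Representation ℚ G W}
  {T T' : Type*} [AddCommGroup T] [Module ℂ T] [FiniteDimensional ℂ T]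
  [AddCommGroup T'] [Module ℂ T'] [FiniteDimensional ℂ T']
  {τ : Representation ℂ G T} {τ' : Representation ℂ G T'}

/-- All complex constituents of an irreducible rational representation have Frobenius–Schur
indicator `1` if one of them has. The central element `|G|⁻¹ ∑ g²` acts on a constituent with
character `χ` as `ν₂(χ) / χ(1)`, hence has a rational eigenvalue, hence is a rational scalar by
Schur's lemma over `ℚ`; so `ν₂(χ) / χ(1)` is the same for all constituents. -/
theorem frobeniusSchur_eq_one_of_common (hρ : ρ.IsIrreducible) (hτ : τ.IsIrreducible)
    (hτ' : τ'.IsIrreducible) (h : homDim τ (ρ.extendScalars ℂ) ≠ 0)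
    (h' : homDim τ' (ρ.extendScalars ℂ) ≠ 0) (h1 : frobeniusSchur τ.character = 1) :
    frobeniusSchur τ'.character = 1 := by
  have := hρ
  obtain ⟨f, hf⟩ := exists_injective_of_homDim_ne_zero hτ h
  obtain ⟨f', hf'⟩ := exists_injective_of_homDim_ne_zero hτ' h'
  have hT := nontrivial_of_isIrreducible hτ
  have hT' := nontrivial_of_isIrreducible hτ'
  set q : ℚ := (Module.finrank ℂ T : ℚ)⁻¹ with hq
  have hscal : ∀ x : ℂ ⊗[ℚ] V, (q • (1 : Module.End ℚ V)).baseChange ℂ x = (q : ℂ) • x := by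
    intro x
    induction x using TensorProduct.induction_on with
    | zero => simp
    | add x y hx hy => rw [map_add, hx, hy, smul_add]
    | tmul a v =>
      rw [LinearMap.baseChange_tmul, LinearMap.smul_apply, Module.End.one_apply,
        TensorProduct.tmul_smul]
      rw [← algebraMap_smul ℂ q]
      rfl
  -- `z` is the difference of the central element and the eigenvalue `q`.
  let z : IntertwiningMap ρ ρ := squareAverage ρ - q • 1
  have hz : ∀ x, z.toLinearMap.baseChange ℂ x =
      squareAverage (ρ.extendScalars ℂ) x - (q : ℂ) • x := by
    intro x
    have : z.toLinearMap = (squareAverage ρ).toLinearMap - q • (1 : Module.End ℚ V) := rfl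
    rw [this, LinearMap.baseChange_sub, LinearMap.sub_apply, hscal, squareAverage_extendScalars]
  have hz0 : z = 0 := by
    refine (IsIrreducible.injective_or_eq_zero z).resolve_left fun hinj => ?_
    obtain ⟨t, ht⟩ := exists_ne (0 : T)
    have hinj' : Function.Injective (z.toLinearMap.baseChange ℂ) :=
      Module.Flat.lTensor_preserves_injective_linearMap z.toLinearMap hinj
    refine ht (hf (hinj' ?_))
    rw [map_zero, map_zero, hz, ← map_squareAverage, squareAverage_eq_smul hτ, h1, map_smul, hq]
    simp
  obtain ⟨t, ht⟩ := exists_ne (0 : T')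
  have h2 := hz (f' t)
  rw [hz0, IntertwiningMap.zero_toLinearMap, LinearMap.baseChange_zero, LinearMap.zero_apply,
    ← map_squareAverage, squareAverage_eq_smul hτ', ← map_smul, ← map_sub, eq_comm,
    map_eq_zero_iff f' hf', ← sub_smul, smul_eq_zero, or_iff_left ht, sub_eq_zero] at h2
  -- The indicator of `τ'` is a positive multiple of that of `τ`, and it is `0`, `1` or `-1`.
  have hd : (0 : ℝ) < Module.finrank ℂ T := Nat.cast_pos.2 Module.finrank_pos
  have hd' : (0 : ℝ) < Module.finrank ℂ T' := Nat.cast_pos.2 Module.finrank_pos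
  have h3 : frobeniusSchur τ'.character =
      (((Module.finrank ℂ T : ℝ)⁻¹ * Module.finrank ℂ T' : ℝ) : ℂ) := by
    rw [div_eq_iff (by exact_mod_cast hd'.ne')] at h2
    rw [h2, hq]
    push_cast
    rfl
  have h4 : 0 < (Module.finrank ℂ T : ℝ)⁻¹ * Module.finrank ℂ T' := by positivity
  rcases frobeniusSchur_mem hτ' with h5 | h5 | h5
  · rw [h5] at h3
    exact absurd (by exact_mod_cast h3.symm) h4.ne'
  · exact h5
  · rw [h5] at h3
    have : (Module.finrank ℂ T : ℝ)⁻¹ * Module.finrank ℂ T' = -1 := by exact_mod_cast h3.symm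
    linarith

/-- An irreducible real representation without a complex structure is absolutely irreducible, and
an invariant inner product on it shows that its Frobenius–Schur indicator is `1`. -/
theorem frobeniusSchur_extendScalars_eq_one {R : Type*} [AddCommGroup R] [Module ℝ R]
    [FiniteDimensional ℝ R] {π : Representation ℝ G R} (hπ : π.IsIrreducible)
    (h : ¬ HasComplexStructure π) :
    (π.extendScalars ℂ).IsIrreducible ∧ frobeniusSchur (π.extendScalars ℂ).character = 1 := by
  classical
  have hirr : (π.extendScalars ℂ).IsIrreducible :=
    isIrreducible_of_homDim_self_eq_one (by rw [homDim_extendScalars, homDim_self_eq_one hπ h])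
  refine ⟨hirr, ?_⟩
  have := nontrivial_of_isIrreducible hπ
  let b := Module.finBasis ℝ R
  let bC := Algebra.TensorProduct.basis ℂ b
  let M : G → Matrix (Fin (Module.finrank ℝ R)) (Fin (Module.finrank ℝ R)) ℝ := fun g =>
    LinearMap.toMatrix b b (π g)
  have hM : ∀ g, LinearMap.toMatrix bC bC (π.extendScalars ℂ g) = (M g).map (algebraMap ℝ ℂ) :=
    fun g => LinearMap.toMatrix_baseChange ℂ (π g) b b
  -- `X` is the Gram matrix of an invariant inner product.
  let X := ∑ g, (M g).transpose * M g
  have hXinv : ∀ g, (M g).transpose * X * M g = X := by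
    intro h
    simp only [X]
    rw [Finset.mul_sum, Finset.sum_mul]
    refine Fintype.sum_equiv (Equiv.mulRight h) _ _ fun g => ?_
    have : M (g * h) = M g * M h := by simp only [M]; rw [map_mul, LinearMap.toMatrix_mul]
    rw [Equiv.coe_mulRight, this, Matrix.transpose_mul]
    simp only [Matrix.mul_assoc]
  have hXsymm : X.transpose = X := by
    simp [X, Matrix.transpose_sum, Matrix.transpose_mul]
  have hX0 : X ≠ 0 := by
    intro h0
    let i : Fin (Module.finrank ℝ R) := ⟨0, Module.finrank_pos⟩
    have h1 := congrArg (fun Y => Y i i) h0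
    have h2 : X i i = ∑ g, ∑ j, M g j i * M g j i := by
      simp [X, Matrix.sum_apply, Matrix.mul_apply]
    have h3 : (1 : ℝ) ≤ X i i := by
      rw [h2]
      refine le_trans ?_ (Finset.single_le_sum (f := fun g => ∑ j, M g j i * M g j i)
        (fun g _ => Finset.sum_nonneg fun j _ => mul_self_nonneg _) (Finset.mem_univ 1))
      refine le_trans ?_ (Finset.single_le_sum (f := fun j => M 1 j i * M 1 j i)
        (fun j _ => mul_self_nonneg _) (Finset.mem_univ i))
      simp [M]
    have h4 : X i i = 0 := h1
    linarith
  refine IsInvariantForm.frobeniusSchur_eq (b := bC) (X := X.map (algebraMap ℝ ℂ)) hirr ?_ ?_ ?_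
  · intro g
    rw [hM, ← Matrix.transpose_map, ← Matrix.map_mul, ← Matrix.map_mul, hXinv]
  · intro h0
    refine hX0 (Matrix.map_injective (algebraMap ℝ ℂ).injective ?_)
    exact h0.trans (Matrix.map_zero _ (map_zero _)).symm
  · rw [one_smul, ← Matrix.transpose_map, hXsymm]

variable (ρ) in
/-- The complex character of a rational representation. -/
theorem character_extendScalars_complex :
    (ρ.extendScalars ℂ).character = fun g => ((ρ.character g : ℚ) : ℂ) :=
  funext fun g => character_extendScalars ρ ℂ g

/-- The multiplicity of a complex irreducible representation in an irreducible rational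
representation containing it is the Schur index. -/
theorem schurIndexRat_eq_homDim (hρ : ρ.IsIrreducible) (hτ : τ.IsIrreducible)
    (h : homDim τ (ρ.extendScalars ℂ) ≠ 0) :
    schurIndexRat τ.character = homDim τ (ρ.extendScalars ℂ) := by
  have hset : {m : ℕ | 0 < m ∧ ∃ (d : ℕ) (σ : Representation ℚ G (Fin d → ℚ)), σ.IsIrreducible ∧
      charInner (fun g => ((σ.character g : ℚ) : ℂ)) τ.character = m} =
      {homDim τ (ρ.extendScalars ℂ)} := by
    ext m
    rw [Set.mem_ofPred_eq, Set.mem_singleton_iff]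
    constructor
    · rintro ⟨hm, d, σ, hσ, hm'⟩
      rw [← character_extendScalars_complex, charInner_character, Nat.cast_inj] at hm'
      have h1 := homDim_ne_zero_of_common hτ h (by omega : homDim τ (σ.extendScalars ℂ) ≠ 0)
      rw [homDim_extendScalars] at h1
      obtain ⟨e⟩ := nonempty_equiv_of_homDim_ne_zero hρ hσ h1
      rw [← hm']
      refine homDim_congr_right ?_ τ
      rw [character_extendScalars_complex, character_extendScalars_complex, char_iso e]
    · rintro rfl
      obtain ⟨σ, ⟨e⟩⟩ := exists_equiv_fin ρ
      refine ⟨Nat.pos_of_ne_zero h, _, σ, isIrreducible_of_equiv e hρ, ?_⟩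
      rw [← char_iso e, ← character_extendScalars_complex, charInner_character]
  rw [schurIndexRat, hset, csInf_singleton]

theorem homDim_extendScalars_extendScalars (π : Representation ℂ G T) :
    homDim π ((ρ.extendScalars ℝ).extendScalars ℂ) = homDim π (ρ.extendScalars ℂ) := by
  refine homDim_congr_right (funext fun g => ?_) π
  rw [character_extendScalars, character_extendScalars, character_extendScalars,
    ← IsScalarTower.algebraMap_apply]

end Rational

end Representation

namespace Representation

variable {G : Type*} [Group G] [Fintype G]

section

variable {k V W U : Type*} [Field k]
  [AddCommGroup V] [Module k V] [FiniteDimensional k V]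
  [AddCommGroup W] [Module k W] [FiniteDimensional k W]
  [AddCommGroup U] [Module k U] [FiniteDimensional k U]
  {ρ : Representation k G V} {σ : Representation k G W} {τ : Representation k G U}

theorem character_extendScalars_eq_add (K : Type*) [Field K] [Algebra k K]
    (h : ρ.character = σ.character + τ.character) :
    (ρ.extendScalars K).character =
      (σ.extendScalars K).character + (τ.extendScalars K).character := by
  funext g
  rw [Pi.add_apply, character_extendScalars, character_extendScalars, character_extendScalars, h,
    Pi.add_apply, map_add]

end

section

variable {V : Type u} [AddCommGroup V] [Module ℚ V] [FiniteDimensional ℚ V]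

/-- Every complex constituent of a rational representation occurs in one of its irreducible rational
constituents. -/
theorem exists_irreducible_constituent (ρ : Representation ℚ G V)
    {T : Type*} [AddCommGroup T] [Module ℂ T] [FiniteDimensional ℂ T]
    {τ : Representation ℂ G T} (h : homDim τ (ρ.extendScalars ℂ) ≠ 0) :
    ∃ (W : Type u) (_ : AddCommGroup W) (_ : Module ℚ W) (_ : FiniteDimensional ℚ W)
      (σ : Representation ℚ G W), σ.IsIrreducible ∧ homDim σ ρ ≠ 0 ∧
        homDim τ (σ.extendScalars ℂ) ≠ 0 := by
  obtain ⟨n, hn⟩ : ∃ n, Module.finrank ℚ V = n := ⟨_, rfl⟩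
  induction n using Nat.strong_induction_on generalizing V with | _ n ih =>
  rcases subsingleton_or_nontrivial V with hV | hV
  · exfalso
    obtain ⟨f, hf⟩ := (homDim_ne_zero_iff _ _).1 h
    obtain ⟨v, hv⟩ := IntertwiningMap.exists_apply_ne_zero hf
    have h0 : Module.finrank ℂ (ℂ ⊗[ℚ] V) = 0 := by
      rw [Module.finrank_baseChange, Module.finrank_zero_of_subsingleton]
    exact hv (finrank_zero_iff_forall_zero.1 h0 _)
  obtain ⟨S, hS⟩ := exists_irreducible_subrepresentation (ρ := ρ)
  have := nontrivial_of_isIrreducible hS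
  have hSpos : 0 < Module.finrank ℚ S.toSubmodule := Module.finrank_pos
  have hinj : Function.Injective S.subtype := Subtype.val_injective
  obtain ⟨T, ⟨e⟩⟩ := exists_equiv_prod_of_injective S.subtype hinj
  have hdim := finrank_eq_add e
  by_cases hτ : homDim τ (S.toRepresentation.extendScalars ℂ) = 0
  · rw [homDim_add_right (character_extendScalars_eq_add ℂ (character_eq_add e)), hτ,
      zero_add] at h
    obtain ⟨W, _, _, _, σ, h1, h2, h3⟩ :=
      ih (Module.finrank ℚ T.toSubmodule) (by omega) T.toRepresentation h rfl
    refine ⟨W, _, _, ‹_›, σ, h1, ?_, h3⟩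
    rw [homDim_add_right (character_eq_add e)]
    omega
  · exact ⟨_, _, _, inferInstance, _, hS, homDim_ne_zero_of_injective _ hinj, hτ⟩

/-- The dimension of a multiplicity-free rational representation without constituents with a
complex structure: each complex constituent `χ` of it has Frobenius–Schur indicator `1` and its
multiplicity is the Schur index of `χ`. -/
theorem finrank_le_sum_schurIndexRat (ρ : Representation ℚ G V)
    (h : ∀ (W : Type u) [AddCommGroup W] [Module ℚ W] [FiniteDimensional ℚ W]
      (σ : Representation ℚ G W), σ.IsIrreducible → homDim σ ρ ≠ 0 →
        ¬ HasComplexStructure (σ.extendScalars ℝ) ∧ homDim σ ρ = homDim σ σ) :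
    (Module.finrank ℚ V : ℝ) ≤ ∑ χ ∈ irrReal G, (schurIndexRat χ : ℝ) * (χ 1).re := by
  classical
  have key : ∀ χ ∈ Irr G, ((charInner (ρ.extendScalars ℂ).character χ) * χ 1).re ≠ 0 →
      χ ∈ irrReal G ∧ charInner (ρ.extendScalars ℂ).character χ = schurIndexRat χ := by
    rintro _ ⟨d, τ, hτ, rfl⟩ hne
    rw [charInner_character]
    have hne' : homDim τ (ρ.extendScalars ℂ) ≠ 0 := by
      intro h0
      rw [charInner_character, h0, Nat.cast_zero, zero_mul] at hne
      exact hne rfl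
    obtain ⟨W, _, _, _, σ, hσ, hσρ, hτσ⟩ := exists_irreducible_constituent ρ hne'
    obtain ⟨hbad, hmult⟩ := h W σ hσ hσρ
    constructor
    · rw [irrReal, Set.Finite.mem_toFinset]
      refine ⟨⟨d, τ, hτ, rfl⟩, ?_⟩
      have h1 : ∃ (R : Type u) (_ : AddCommGroup R) (_ : Module ℝ R) (_ : FiniteDimensional ℝ R)
          (π : Representation ℝ G R), π.IsIrreducible ∧ ¬ HasComplexStructure π ∧
            ¬ Even (homDim π (σ.extendScalars ℝ)) := by
        by_contra! hcon
        exact hbad (hasComplexStructure_of_even fun R _ _ _ π => hcon R _ _ ‹_› π)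
      obtain ⟨R, _, _, _, π, hπ, hπ', hodd⟩ := h1
      obtain ⟨hirr, hν⟩ := frobeniusSchur_extendScalars_eq_one hπ hπ'
      refine frobeniusSchur_eq_one_of_common hσ hirr hτ ?_ hτσ hν
      rw [← homDim_extendScalars_extendScalars, homDim_extendScalars]
      intro h0
      rw [h0] at hodd
      exact hodd ⟨0, rfl⟩
    · -- The complement of `σ` contains no further copy of `σ`, hence none of `τ`.
      rw [Nat.cast_inj, schurIndexRat_eq_homDim hσ hτ hτσ]
      obtain ⟨f, hf⟩ := exists_injective_of_homDim_ne_zero hσ hσρ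
      obtain ⟨S, ⟨e⟩⟩ := exists_equiv_prod_of_injective f hf
      have h1 : homDim σ S.toRepresentation = 0 := by
        rw [homDim_add_right (character_eq_add e)] at hmult
        omega
      have h2 : homDim τ (S.toRepresentation.extendScalars ℂ) = 0 := by
        by_contra hne2
        have h3 := homDim_ne_zero_of_common hτ hτσ hne2
        rw [homDim_extendScalars] at h3
        exact h3 h1
      rw [homDim_add_right (character_extendScalars_eq_add ℂ (character_eq_add e)), h2, add_zero]
  have hsub : irrReal G ⊆ (irr_finite G).toFinset := by
    intro χ hχ
    rw [irrReal, Set.Finite.mem_toFinset] at hχ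
    exact (irr_finite G).mem_toFinset.2 hχ.1
  have h1 := congrArg Complex.re (character_eq_sum_irr (ρ.extendScalars ℂ) 1)
  rw [char_one, Module.finrank_baseChange, Complex.natCast_re, Complex.re_sum] at h1
  rw [h1, ← Finset.sum_subset hsub]
  · refine Finset.sum_le_sum fun χ hχ => ?_
    by_cases h0 : ((charInner (ρ.extendScalars ℂ).character χ) * χ 1).re = 0
    · rw [h0]
      obtain ⟨d, τ, hτ, rfl⟩ := (irr_finite G).mem_toFinset.1 (hsub hχ)
      rw [char_one, Complex.natCast_re]
      positivity
    · rw [(key χ ((irr_finite G).mem_toFinset.1 (hsub hχ)) h0).2]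
      simp
  · intro χ hχ hχ'
    by_contra h0
    exact hχ' (key χ ((irr_finite G).mem_toFinset.1 hχ) h0).1

/-- Peel off the irreducible constituents of `ρ` together with copies of them in `μ`. -/
theorem finrank_le_of_homDim_le (ρ : Representation ℚ G V) {U : Type*} [AddCommGroup U]
    [Module ℚ U] [FiniteDimensional ℚ U] (μ : Representation ℚ G U)
    (h : ∀ (W : Type u) [AddCommGroup W] [Module ℚ W] [FiniteDimensional ℚ W]
      (σ : Representation ℚ G W), σ.IsIrreducible → homDim σ ρ ≤ homDim σ μ) :
    Module.finrank ℚ V ≤ Module.finrank ℚ U := by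
  obtain ⟨n, hn⟩ : ∃ n, Module.finrank ℚ V = n := ⟨_, rfl⟩
  induction n using Nat.strong_induction_on generalizing V U with | _ n ih =>
  rcases subsingleton_or_nontrivial V with hV | hV
  · rw [Module.finrank_zero_of_subsingleton]
    exact Nat.zero_le _
  obtain ⟨S, hS⟩ := exists_irreducible_subrepresentation (ρ := ρ)
  have := nontrivial_of_isIrreducible hS
  have hSpos : 0 < Module.finrank ℚ S.toSubmodule := Module.finrank_pos
  have hinj : Function.Injective S.subtype := Subtype.val_injective
  obtain ⟨T, ⟨e⟩⟩ := exists_equiv_prod_of_injective S.subtype hinj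
  have hdim := finrank_eq_add e
  have h1 : homDim S.toRepresentation μ ≠ 0 := by
    have h2 := h _ S.toRepresentation hS
    have h3 := homDim_ne_zero_of_injective _ hinj
    omega
  obtain ⟨f, hf⟩ := exists_injective_of_homDim_ne_zero hS h1
  obtain ⟨R, ⟨e'⟩⟩ := exists_equiv_prod_of_injective f hf
  have hdim' := finrank_eq_add e'
  have hle := ih (Module.finrank ℚ T.toSubmodule) (by omega) T.toRepresentation
    R.toRepresentation (fun W _ _ _ σ hσ => by
      have h2 := h W σ hσ
      rw [homDim_add_right (character_eq_add e), homDim_add_right (character_eq_add e')] at h2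
      omega) rfl
  omega

/-- If `U × P` has a complex structure over `ℝ`, then so has `U × P'` for a quotient `P'` of `P`
of small dimension. In a quotient of minimal dimension no irreducible constituent has a complex
structure and none occurs twice, since these could be split off; and each occurs in `U`, since
otherwise it would be the whole isotypic component of `U × P'`. -/
theorem exists_quotient_hasComplexStructure {U P : Type u} [AddCommGroup U] [Module ℚ U]
    [FiniteDimensional ℚ U] [AddCommGroup P] [Module ℚ P] [FiniteDimensional ℚ P]
    (μ : Representation ℚ G U) (ρ : Representation ℚ G P)
    (h : HasComplexStructure ((μ.prod ρ).extendScalars ℝ)) :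
    ∃ (P' : Type u) (_ : AddCommGroup P') (_ : Module ℚ P') (_ : FiniteDimensional ℚ P')
      (ρ' : Representation ℚ G P') (f : IntertwiningMap ρ ρ'), Function.Surjective f ∧
        HasComplexStructure ((μ.prod ρ').extendScalars ℝ) ∧
        Module.finrank ℚ P' ≤ Module.finrank ℚ U ∧
        (Module.finrank ℚ P' : ℝ) ≤ ∑ χ ∈ irrReal G, (schurIndexRat χ : ℝ) * (χ 1).re := by
  obtain ⟨n, hn⟩ : ∃ n, Module.finrank ℚ P = n := ⟨_, rfl⟩
  induction n using Nat.strong_induction_on generalizing P with | _ n ih =>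
  by_cases hex : ∃ (P' : Type u) (_ : AddCommGroup P') (_ : Module ℚ P')
      (_ : FiniteDimensional ℚ P') (ρ' : Representation ℚ G P') (f : IntertwiningMap ρ ρ'),
      Function.Surjective f ∧ HasComplexStructure ((μ.prod ρ').extendScalars ℝ) ∧
        Module.finrank ℚ P' < n
  · obtain ⟨P', _, _, _, ρ', f, hf, hcs, hlt⟩ := hex
    obtain ⟨P'', i1, i2, i3, ρ'', f', hf', h'⟩ := ih _ hlt ρ' hcs rfl
    exact ⟨P'', i1, i2, i3, ρ'', f'.comp f, hf'.comp hf, h'⟩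
  have hmin : ∀ (P' : Type u) [AddCommGroup P'] [Module ℚ P'] [FiniteDimensional ℚ P']
      (ρ' : Representation ℚ G P') (f : IntertwiningMap ρ ρ'), Function.Surjective f →
      HasComplexStructure ((μ.prod ρ').extendScalars ℝ) → n ≤ Module.finrank ℚ P' := by
    intro P' _ _ _ ρ' f hf hcs
    by_contra! hlt
    exact hex ⟨P', _, _, ‹_›, ρ', f, hf, hcs, hlt⟩
  have key : ∀ (W : Type u) [AddCommGroup W] [Module ℚ W] [FiniteDimensional ℚ W]
      (σ : Representation ℚ G W), σ.IsIrreducible → homDim σ ρ ≠ 0 →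
      ¬ HasComplexStructure (σ.extendScalars ℝ) ∧ homDim σ ρ = homDim σ σ ∧
        homDim σ μ ≠ 0 := by
    intro W _ _ _ σ hσ hne
    have := nontrivial_of_isIrreducible hσ
    have hWpos : 0 < Module.finrank ℚ W := Module.finrank_pos
    obtain ⟨f, hf⟩ := exists_injective_of_homDim_ne_zero hσ hne
    obtain ⟨S, ⟨e⟩⟩ := exists_equiv_prod_of_injective f hf
    have hdim := finrank_eq_add e
    let p : IntertwiningMap ρ S.toRepresentation :=
      (IntertwiningMap.snd ℚ σ S.toRepresentation).comp e.toIntertwiningMap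
    have hp : Function.Surjective p :=
      (IntertwiningMap.snd_surjective σ S.toRepresentation).comp e.toLinearEquiv.surjective
    have hchar : (μ.prod ρ).character = (μ.prod S.toRepresentation).character + σ.character := by
      funext g
      rw [Pi.add_apply, character_prod, character_prod, character_eq_add e, Pi.add_apply]
      ring
    have hcharR := character_extendScalars_eq_add ℝ hchar
    have hbad : ¬ HasComplexStructure (σ.extendScalars ℝ) := by
      intro hcs
      have := hmin _ S.toRepresentation p hp (h.cancel hcs hcharR)
      omega
    have hmult : homDim σ S.toRepresentation = 0 := by
      by_contra hne'
      obtain ⟨f', hf'⟩ := exists_injective_of_homDim_ne_zero hσ hne'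
      obtain ⟨R, ⟨e'⟩⟩ := exists_equiv_prod_of_injective f' hf'
      have hdim' := finrank_eq_add e'
      have hchar' : ((μ.prod ρ).extendScalars ℝ).character =
          ((μ.prod R.toRepresentation).extendScalars ℝ).character +
            ((σ.extendScalars ℝ).prod (σ.extendScalars ℝ)).character := by
        funext g
        rw [Pi.add_apply, character_prod, character_extendScalars, character_extendScalars,
          character_extendScalars, character_prod, character_prod, character_eq_add e,
          Pi.add_apply, character_eq_add e', Pi.add_apply]
        simp only [map_add]
        ring
      have := hmin _ R.toRepresentation
        (((IntertwiningMap.snd ℚ σ R.toRepresentation).comp e'.toIntertwiningMap).comp p)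
        (((IntertwiningMap.snd_surjective σ R.toRepresentation).comp
          e'.toLinearEquiv.surjective).comp hp)
        (h.cancel (hasComplexStructure_prod_self _) hchar')
      omega
    refine ⟨hbad, ?_, ?_⟩
    · rw [homDim_add_right (character_eq_add e), hmult, add_zero]
    · -- If `σ` does not occur in `μ`, some real constituent `π` of `σ` has odd multiplicity in
      -- `μ × ρ`.
      intro hμ
      have h1 : ∃ (R : Type u) (_ : AddCommGroup R) (_ : Module ℝ R) (_ : FiniteDimensional ℝ R)
          (π : Representation ℝ G R), π.IsIrreducible ∧ ¬ HasComplexStructure π ∧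
            ¬ Even (homDim π (σ.extendScalars ℝ)) := by
        by_contra! hcon
        exact hbad (hasComplexStructure_of_even fun R _ _ _ π => hcon R _ _ ‹_› π)
      obtain ⟨R, _, _, _, π, hπ, -, hodd⟩ := h1
      have h2 := h.even_homDim π
      rw [homDim_add_right hcharR, Nat.even_add] at h2
      have h3 : homDim π ((μ.prod S.toRepresentation).extendScalars ℝ) ≠ 0 := fun h0 =>
        hodd (h2.1 ⟨0, h0⟩)
      have h4 : homDim π (σ.extendScalars ℝ) ≠ 0 := fun h0 => hodd ⟨0, h0⟩
      have h5 := homDim_ne_zero_of_common hπ h4 h3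
      rw [homDim_extendScalars, homDim_add_right (funext fun g => character_prod _ _ g)] at h5
      omega
  refine ⟨P, _, _, ‹_›, ρ, IntertwiningMap.id ρ, Function.surjective_id, h, ?_, ?_⟩
  · refine finrank_le_of_homDim_le ρ μ fun W _ _ _ σ hσ => ?_
    by_cases hne : homDim σ ρ = 0
    · rw [hne]
      exact Nat.zero_le _
    · obtain ⟨-, h2, h3⟩ := key W σ hσ hne
      obtain ⟨f, hf⟩ := exists_injective_of_homDim_ne_zero hσ h3
      obtain ⟨R, ⟨e⟩⟩ := exists_equiv_prod_of_injective f hf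
      rw [h2, homDim_add_right (character_eq_add e)]
      exact Nat.le_add_right _ _
  · exact finrank_le_sum_schurIndexRat ρ fun W _ _ _ σ hσ hne =>
      ⟨(key W σ hσ hne).1, (key W σ hσ hne).2.1⟩

end

end Representation

/-! ### Complex structures on lattices -/

/-- A subgroup spanning a rational vector space becomes equal to it on inverting the nonzero
integers. -/
theorem isBaseChange_rat_of_span_eq_top {L X : Type*} [AddCommGroup L] [AddCommGroup X]
    [Module ℚ X] (j : L →ₗ[ℤ] X) (hj : Function.Injective j)
    (hspan : Submodule.span ℚ (Set.range j) = ⊤) : IsBaseChange ℚ j := by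
  have hdiv : ∀ y, ∃ (n : ℤ) (l : L), n ≠ 0 ∧ n • y = j l := by
    intro y
    have hy : y ∈ Submodule.span ℚ (Set.range j) := by rw [hspan]; trivial
    induction hy using Submodule.span_induction with
    | mem y hy =>
      obtain ⟨l, rfl⟩ := hy
      exact ⟨1, l, one_ne_zero, one_smul _ _⟩
    | zero => exact ⟨1, 0, one_ne_zero, by simp⟩
    | add y z _ _ hy hz =>
      obtain ⟨n, l, hn, hl⟩ := hy
      obtain ⟨m, k, hm, hk⟩ := hz
      refine ⟨n * m, m • l + n • k, mul_ne_zero hn hm, ?_⟩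
      rw [map_add, map_smul, map_smul, ← hl, ← hk, smul_smul, smul_smul, smul_add, mul_comm m n]
    | smul q y _ hy =>
      obtain ⟨n, l, hn, hl⟩ := hy
      refine ⟨n * q.den, q.num • l, mul_ne_zero hn (by exact_mod_cast q.den_nz), ?_⟩
      rw [map_smul, ← hl, smul_smul, ← Int.cast_smul_eq_zsmul ℚ, ← Int.cast_smul_eq_zsmul ℚ,
        smul_smul]
      congr 1
      push_cast
      rw [mul_assoc, Rat.den_mul_eq_num, mul_comm]
  rw [← isLocalizedModule_iff_isBaseChange (nonZeroDivisors ℤ) ℚ j]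
  refine ⟨fun n => ?_, fun y => ?_, fun {x y} h => ⟨1, by rw [hj h]⟩⟩
  · have hn : ((n : ℤ) : ℚ) ≠ 0 := Int.cast_ne_zero.2 (nonZeroDivisors.ne_zero n.2)
    rw [Module.End.isUnit_iff]
    constructor
    · intro x y h
      have h' : (n : ℤ) • x = (n : ℤ) • y := h
      rw [← Int.cast_smul_eq_zsmul ℚ, ← Int.cast_smul_eq_zsmul ℚ] at h'
      exact smul_right_injective X hn h'
    · intro y
      refine ⟨((n : ℤ) : ℚ)⁻¹ • y, ?_⟩
      change (n : ℤ) • (((n : ℤ) : ℚ)⁻¹ • y) = y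
      rw [← Int.cast_smul_eq_zsmul ℚ, smul_smul, mul_inv_cancel₀ hn, one_smul]
  · obtain ⟨n, l, hn, hl⟩ := hdiv y
    exact ⟨(l, ⟨n, mem_nonZeroDivisors_of_ne_zero hn⟩), hl⟩

namespace Representation

variable {G : Type*} [Group G]

/-- A lattice spanning a rational representation determines it, and both have the same extension
of scalars to `ℝ`. -/
theorem exists_equiv_extendScalars_real {L X : Type*} [AddCommGroup L] [AddCommGroup X]
    [Module ℚ X] {ρ : Representation ℤ G L} {ξ : Representation ℚ G X} (j : L →ₗ[ℤ] X)
    (hj : Function.Injective j) (hspan : Submodule.span ℚ (Set.range j) = ⊤)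
    (hcomm : ∀ g l, j (ρ g l) = ξ g (j l)) :
    Nonempty (Equiv (ρ.extendScalars ℝ) (ξ.extendScalars ℝ)) := by
  have h := (isBaseChange_rat_of_span_eq_top j hj hspan).comp (TensorProduct.isBaseChange ℚ X ℝ)
  refine ⟨Equiv.mk h.equiv fun g => ?_⟩
  ext l
  change h.equiv (1 ⊗ₜ ρ g l) = (ξ g).baseChange ℝ (h.equiv (1 ⊗ₜ l))
  rw [IsBaseChange.equiv_tmul, IsBaseChange.equiv_tmul, one_smul, one_smul]
  change 1 ⊗ₜ j (ρ g l) = (ξ g).baseChange ℝ (1 ⊗ₜ j l)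
  rw [hcomm, LinearMap.baseChange_tmul]

/-- A `G`-stable pure sublattice `N` of a lattice with a complex structure contains a pure
sublattice `M` such that `L / M` has a complex structure, with two bounds for the rank of `L / M`.
Rationally `L` is `L / N × K`, where `K` is the span of `N`, and `M` is the kernel of the map from
`L` to `L / N × P`, where `P` is the quotient of `K` from `exists_quotient_hasComplexStructure`. -/
theorem exists_submodule_hasComplexStructure [Fintype G] {L : Type u} [AddCommGroup L]
    [Module.Free ℤ L] [Module.Finite ℤ L] (ρ : Representation ℤ G L)
    (hρ : HasComplexStructure (ρ.extendScalars ℝ)) (N : Submodule ℤ L)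
    (hN : ∀ g, N ≤ N.comap (ρ g)) [Module.IsTorsionFree ℤ (L ⧸ N)] :
    ∃ (M : Submodule ℤ L) (hM : ∀ g, M ≤ M.comap (ρ g)), M ≤ N ∧
      Module.IsTorsionFree ℤ (L ⧸ M) ∧
      HasComplexStructure ((ρ.quotient M hM).extendScalars ℝ) ∧
      Module.finrank ℤ (L ⧸ M) ≤ 2 * Module.finrank ℤ (L ⧸ N) ∧
      (Module.finrank ℤ (L ⧸ M) : ℝ) ≤ Module.finrank ℤ (L ⧸ N) +
        ∑ χ ∈ irrReal G, (schurIndexRat χ : ℝ) * (χ 1).re := by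
  have hfree : Module.Free ℤ (L ⧸ N) := inferInstance
  let ρQ := ρ.extendScalars ℚ
  let μ := (ρ.quotient N hN).extendScalars ℚ
  let q : IntertwiningMap ρ (ρ.quotient N hN) := ⟨N.mkQ, fun _ => rfl⟩
  let π : IntertwiningMap ρQ μ := q.extendScalars ℚ
  have hπ : Function.Surjective π := LinearMap.lTensor_surjective ℚ N.mkQ_surjective
  let K : Subrepresentation ρQ := π.ker
  obtain ⟨S, e, he⟩ := exists_equiv_prod_apply_eq K.subtype Subtype.val_injective
  -- `r` is an equivariant retraction onto the kernel `K` of `π`.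
  let r : IntertwiningMap ρQ K.toRepresentation :=
    (IntertwiningMap.fst ℚ K.toRepresentation S.toRepresentation).comp e.toIntertwiningMap
  have hr : ∀ k : K.toSubmodule, r k = k := fun k => congrArg Prod.fst (he k)
  let i : L →ₗ[ℤ] ℚ ⊗[ℤ] L := TensorProduct.mk ℤ ℚ L 1
  have hi : Function.Injective i := Module.Flat.tensorProduct_mk_injective ℤ L ℚ
  have hispan : Submodule.span ℚ (Set.range i) = ⊤ := by
    rw [eq_top_iff]
    rintro x -
    induction x using TensorProduct.induction_on with
    | zero => exact zero_mem _
    | add x y hx hy => exact add_mem hx hy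
    | tmul a l =>
      have : a ⊗ₜ[ℤ] l = a • i l := by
        change _ = a • ((1 : ℚ) ⊗ₜ[ℤ] l)
        rw [TensorProduct.smul_tmul', smul_eq_mul, mul_one]
      rw [this]
      exact Submodule.smul_mem _ _ (Submodule.subset_span ⟨l, rfl⟩)
  have hspan : ∀ {X : Type u} [AddCommGroup X] [Module ℚ X] (F : ℚ ⊗[ℤ] L →ₗ[ℚ] X),
      Function.Surjective F → Submodule.span ℚ (Set.range fun l => F (i l)) = ⊤ := by
    intro X _ _ F hF
    have : Set.range (fun l => F (i l)) = F '' Set.range i := (Set.range_comp F i)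
    rw [this, ← Submodule.map_span, hispan, Submodule.map_top, LinearMap.range_eq_top.2 hF]
  have hicomm : ∀ g l, i (ρ g l) = ρQ g (i l) := fun g l => rfl
  have hK : HasComplexStructure ((μ.prod K.toRepresentation).extendScalars ℝ) := by
    let F : IntertwiningMap ρQ (μ.prod K.toRepresentation) := IntertwiningMap.prod π r
    have hF : ∀ v, F v = (π v, r v) := fun _ => rfl
    have hFinj : Function.Injective F := by
      rw [injective_iff_map_eq_zero]
      intro v hv
      rw [hF, Prod.mk_eq_zero] at hv
      exact (congrArg Subtype.val (hr ⟨v, hv.1⟩)).symm.trans (congrArg Subtype.val hv.2)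
    have hFsurj : Function.Surjective F := by
      rintro ⟨u, k⟩
      obtain ⟨v, rfl⟩ := hπ u
      refine ⟨v + (k - r v : K.toSubmodule), ?_⟩
      rw [hF, map_add, map_add, hr]
      have : π ((k - r v : K.toSubmodule) : ℚ ⊗[ℤ] L) = 0 := (k - r v : K.toSubmodule).2
      rw [this, add_zero, add_sub_cancel]
    obtain ⟨e'⟩ := exists_equiv_extendScalars_real (ρ := ρ) (ξ := μ.prod K.toRepresentation)
      ((F.toLinearMap.restrictScalars ℤ) ∘ₗ i) (hFinj.comp hi) (hspan F.toLinearMap hFsurj)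
      (fun g l => (congrArg F (hicomm g l)).trans (F.isIntertwining _ _ g (i l)))
    exact hρ.of_equiv e'
  obtain ⟨P, _, _, _, ρP, f, hf, hcs, hle, hle'⟩ := exists_quotient_hasComplexStructure μ _ hK
  let F : IntertwiningMap ρQ (μ.prod ρP) := IntertwiningMap.prod π (f.comp r)
  have hF : ∀ v, F v = (π v, f (r v)) := fun _ => rfl
  have hFsurj : Function.Surjective F := by
    rintro ⟨u, p⟩
    obtain ⟨v, rfl⟩ := hπ u
    obtain ⟨k, hk⟩ := hf (p - f (r v))
    refine ⟨v + (k : ℚ ⊗[ℤ] L), ?_⟩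
    have : π (k : ℚ ⊗[ℤ] L) = 0 := k.2
    rw [hF, map_add, map_add, hr, this, add_zero, map_add, hk, add_sub_cancel]
  let Fz : L →ₗ[ℤ] (ℚ ⊗[ℤ] (L ⧸ N)) × P := (F.toLinearMap.restrictScalars ℤ) ∘ₗ i
  have hFz : ∀ l, Fz l = F (i l) := fun _ => rfl
  have hFzcomm : ∀ g l, Fz (ρ g l) = (μ.prod ρP) g (Fz l) := fun g l => by
    rw [hFz, hicomm, F.isIntertwining]
    rfl
  let M := LinearMap.ker Fz
  have hM : ∀ g, M ≤ M.comap (ρ g) := by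
    intro g l hl
    rw [Submodule.mem_comap, LinearMap.mem_ker, hFzcomm, LinearMap.mem_ker.1 hl, map_zero]
  let j : L ⧸ M →ₗ[ℤ] (ℚ ⊗[ℤ] (L ⧸ N)) × P := M.liftQ Fz le_rfl
  have hj : Function.Injective j := LinearMap.ker_eq_bot.1 (Submodule.ker_liftQ_eq_bot _ _ _ le_rfl)
  have hjspan : Submodule.span ℚ (Set.range j) = ⊤ := by
    rw [← hspan F.toLinearMap hFsurj]
    congr 1
    ext x
    constructor
    · rintro ⟨l, rfl⟩
      obtain ⟨l, rfl⟩ := M.mkQ_surjective l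
      exact ⟨l, rfl⟩
    · rintro ⟨l, rfl⟩
      exact ⟨M.mkQ l, rfl⟩
  have : Module.IsTorsionFree ℤ ((ℚ ⊗[ℤ] (L ⧸ N)) × P) := .trans_faithfulSMul ℤ ℚ _
  have htf : Module.IsTorsionFree ℤ (L ⧸ M) := hj.moduleIsTorsionFree j (fun n x => map_smul j n x)
  have hfree' : Module.Free ℤ (L ⧸ M) := inferInstance
  have hfr : Module.finrank ℤ (L ⧸ M) = Module.finrank ℤ (L ⧸ N) + Module.finrank ℚ P := by
    have h1 := (isBaseChange_rat_of_span_eq_top j hj hjspan).equiv.finrank_eq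
    rwa [Module.finrank_prod, Module.finrank_baseChange, Module.finrank_baseChange] at h1
  refine ⟨M, hM, ?_, htf, ?_, ?_, ?_⟩
  · intro l hl
    have h0 : (1 : ℚ) ⊗ₜ[ℤ] N.mkQ l = 0 := congrArg Prod.fst (LinearMap.mem_ker.1 hl)
    rw [← Submodule.ker_mkQ N, LinearMap.mem_ker]
    refine Module.Flat.tensorProduct_mk_injective ℤ (L ⧸ N) ℚ ?_
    rw [map_zero]
    exact h0
  · obtain ⟨e'⟩ := exists_equiv_extendScalars_real (ρ := ρ.quotient M hM) (ξ := μ.prod ρP) j hj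
      hjspan (fun g l => by
        obtain ⟨l, rfl⟩ := M.mkQ_surjective l
        exact hFzcomm g l)
    exact hcs.of_equiv e'.symm
  · rw [Module.finrank_baseChange] at hle
    omega
  · rw [hfr, Nat.cast_add]
    linarith

end Representation

/-! ### From extensions to flat Kähler groups -/

namespace Representation

variable {G V : Type*} [Group G] [AddCommGroup V] [Module ℝ V]

/-- A real representation of a finite group with an invariant complex structure is the restriction
of scalars of a unitary representation. -/
theorem HasComplexStructure.exists_unitary [Finite G] [FiniteDimensional ℝ V]
    {ρ : Representation ℝ G V} (h : HasComplexStructure ρ) :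
    ∃ (d : ℕ) (U : G →* (EuclideanSpace ℂ (Fin d) ≃ₗᵢ[ℂ] EuclideanSpace ℂ (Fin d)))
      (Φ : V ≃ₗ[ℝ] EuclideanSpace ℂ (Fin d)), ∀ g v, Φ (ρ g v) = U g (Φ v) := by
  have := Fintype.ofFinite G
  obtain ⟨J, hJ⟩ := h
  let A : ℂ →ₐ[ℝ] Module.End ℝ V := Complex.liftAux J.toLinearMap (LinearMap.ext fun v => hJ v)
  let : Module ℂ V := Module.compHom V A.toRingHom
  have hsmul : ∀ (z : ℂ) (v : V), z • v = z.re • v + z.im • J v := fun z v => by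
    change A z v = _
    rw [Complex.liftAux_apply, Algebra.algebraMap_eq_smul_one]
    rfl
  have : IsScalarTower ℝ ℂ V := ⟨fun r z v => by
    change A (r • z) v = r • A z v
    rw [map_smul]
    rfl⟩
  have : FiniteDimensional ℂ V := FiniteDimensional.right ℝ ℂ V
  let σ : Representation ℂ G V :=
    { toFun := fun g =>
        { toFun := ρ g
          map_add' := map_add _
          map_smul' := fun z v => by
            rw [RingHom.id_apply, hsmul, hsmul, map_add, map_smul, map_smul,
              ← J.isIntertwining] }
      map_one' := LinearMap.ext fun v => LinearMap.congr_fun (map_one ρ) v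
      map_mul' := fun g h => LinearMap.ext fun v => LinearMap.congr_fun (map_mul ρ g h) v }
  obtain ⟨Φ, hΦ⟩ := σ.exists_unitary_coordinates
  have hσ : ∀ g h v, σ g (σ h v) = σ (g * h) v := fun g h v => by
    rw [map_mul, Module.End.mul_apply]
  let U : G → (EuclideanSpace ℂ (Fin (Module.finrank ℂ V)) ≃ₗᵢ[ℂ]
      EuclideanSpace ℂ (Fin (Module.finrank ℂ V))) := fun g =>
    ⟨LinearEquiv.ofLinearMap (Φ.conj (σ g)) (Φ.conj (σ g⁻¹))
      (by
        ext1 x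
        simp only [LinearMap.comp_apply, LinearEquiv.conj_apply_apply, LinearEquiv.symm_apply_apply,
          hσ, mul_inv_cancel, map_one, Module.End.one_apply, LinearEquiv.apply_symm_apply,
          LinearMap.id_apply])
      (by
        ext1 x
        simp only [LinearMap.comp_apply, LinearEquiv.conj_apply_apply, LinearEquiv.symm_apply_apply,
          hσ, inv_mul_cancel, map_one, Module.End.one_apply, LinearEquiv.apply_symm_apply,
          LinearMap.id_apply]), fun x => by
      change ‖Φ (σ g (Φ.symm x))‖ = ‖x‖
      rw [hΦ, Φ.apply_symm_apply]⟩
  have hU : ∀ g x, U g x = Φ (σ g (Φ.symm x)) := fun _ _ => rfl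
  refine ⟨_, ⟨⟨U, ?_⟩, ?_⟩, Φ.restrictScalars ℝ, fun g v => ?_⟩
  · ext1 x
    rw [hU, map_one, Module.End.one_apply, Φ.apply_symm_apply]
    rfl
  · intro g h
    ext1 x
    change U (g * h) x = U g (U h x)
    rw [hU, hU, hU, Φ.symm_apply_apply, hσ]
  · change Φ (σ g v) = Φ (σ g (Φ.symm (Φ v)))
    rw [Φ.symm_apply_apply]

end Representation

namespace LatticeExtension

variable {E Q L : Type*} [Group E] [Group Q] [AddCommGroup L] {ρ : Representation ℤ Q L}
  (X : LatticeExtension E ρ)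

/-- An equivariant map `j : L → W` into a real representation extends to a crossed homomorphism on
`E`: average the images of the defects of an element over the section. -/
noncomputable def averagedDefect [Fintype Q] {W : Type*} [AddCommGroup W] [Module ℝ W]
    (j : L →ₗ[ℤ] W) (e : E) : W :=
  (Nat.card Q : ℝ)⁻¹ • ∑ q, j (X.defect e q)

theorem averagedDefect_mul [Fintype Q] {W : Type*} [AddCommGroup W] [Module ℝ W] (j : L →ₗ[ℤ] W)
    (U : Q → W →ₗ[ℝ] W) (hU : ∀ q l, j (ρ q l) = U q (j l)) (e f : E) :
    X.averagedDefect j (e * f) = X.averagedDefect j e + U (X.proj e) (X.averagedDefect j f) := by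
  simp only [averagedDefect, defect_mul, map_add, Finset.sum_add_distrib, smul_add, map_smul,
    map_sum, hU]
  congr 2
  exact Equiv.sum_comp (Equiv.mulLeft (X.proj f)) fun q => j (X.defect e q)

theorem averagedDefect_incl [Fintype Q] {W : Type*} [AddCommGroup W] [Module ℝ W] (j : L →ₗ[ℤ] W)
    (l : L) :
    X.averagedDefect j (X.incl l) = j l := by
  simp only [averagedDefect, defect_incl, Finset.sum_const, Finset.card_univ]
  rw [← Nat.card_eq_fintype_card, ← Nat.cast_smul_eq_nsmul ℝ, smul_smul,
    inv_mul_cancel₀ (Nat.cast_ne_zero.2 Nat.card_pos.ne'), one_smul]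

theorem exists_incl_eq_pow [Finite Q] (e : E) : ∃ l, X.incl l = e ^ Nat.card Q := by
  rw [← X.proj_eq_one_iff, map_pow, pow_card_eq_one']

/-- A torsion-free extension of a finite group by a lattice with an invariant complex structure on
`ℝ ⊗ L` acts on `ℂᵈ = ℝ ⊗ L` as the fundamental group of a compact flat Kähler manifold: `e` acts
as `x ↦ s(e) + e x` for the crossed homomorphism `s` of `averagedDefect`. -/
theorem exists_isFlatKahlerGroup [Finite Q] [Module.Free ℤ L] [Module.Finite ℤ L]
    (hE : HasNoTorsion E) (hρ : (ρ.extendScalars ℝ).HasComplexStructure) :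
    ∃ (d : ℕ) (Γ : Subgroup (UnitaryAffineGroup d)) (f : E ≃* Γ),
      Module.finrank ℤ L = 2 * d ∧ IsFlatKahlerGroup Γ ∧
        ∀ e, linearPart d (f e) = 1 ↔ ρ (X.proj e) = 1 := by
  have := Fintype.ofFinite Q
  obtain ⟨d, U, Φ, hΦ⟩ := hρ.exists_unitary
  let W := EuclideanSpace ℂ (Fin d)
  let j : L →ₗ[ℤ] W := Φ.toLinearMap.restrictScalars ℤ ∘ₗ TensorProduct.mk ℤ ℝ L 1
  have hj : Function.Injective j :=
    Φ.injective.comp (Module.Flat.tensorProduct_mk_injective ℤ L ℝ)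
  have hjU : ∀ q l, j (ρ q l) = U q (j l) := fun q l => hΦ q (1 ⊗ₜ l)
  let b : Module.Basis _ ℝ W :=
    (Algebra.TensorProduct.basis ℝ (Module.Free.chooseBasis ℤ L)).map Φ
  have hb : ∀ i, b i = j (Module.Free.chooseBasis ℤ L i) := fun i => by
    simp only [b, Module.Basis.map_apply, Algebra.TensorProduct.basis_apply]
    rfl
  have hrange : Submodule.span ℤ (Set.range b) = LinearMap.range j := by
    have : Set.range b = j '' Set.range (Module.Free.chooseBasis ℤ L) := by
      rw [← Set.range_comp]
      exact congrArg Set.range (funext hb)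
    rw [this, ← Submodule.map_span, (Module.Free.chooseBasis ℤ L).span_eq, Submodule.map_top]
  let s := X.averagedDefect j
  have hs : ∀ e f, s (e * f) = s e + U (X.proj e) (s f) := fun e f =>
    X.averagedDefect_mul j (fun q => (U q).toLinearEquiv.toLinearMap.restrictScalars ℝ) hjU e f
  have hsl : ∀ l, s (X.incl l) = j l := X.averagedDefect_incl j
  let A : E →* UnitaryAffineGroup d := MonoidHom.mk' (fun e =>
    (U (X.proj e)).toAffineIsometryEquiv.trans (AffineIsometryEquiv.constVAdd ℂ W (s e))) (by
      intro e f
      ext1 x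
      change s (e * f) + U (X.proj (e * f)) x = s e + U (X.proj e) (s f + U (X.proj f) x)
      rw [hs, map_mul, map_mul, map_add, add_assoc]
      rfl)
  have hA : ∀ e x, A e x = s e + U (X.proj e) x := fun _ _ => rfl
  have hAl : ∀ l x, A (X.incl l) x = j l + x := fun l x => by
    rw [hA, hsl, X.proj_incl, map_one]
    rfl
  have hlin : ∀ e, linearPart d (A e) = U (X.proj e) := fun e => by
    ext1 x
    have h1 := (A e).map_vadd 0 x
    rw [hA, hA, map_zero, add_zero, vadd_eq_add, add_zero, vadd_eq_add, add_comm] at h1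
    exact (add_right_cancel h1).symm
  -- The `|Q|`-th power of an element with a fixed point is a translation with a fixed point.
  have hfree : ∀ e x, A e x = x → e = 1 := by
    intro e x hx
    refine hE e (Nat.card Q) Nat.card_pos ?_
    obtain ⟨l, hl⟩ := X.exists_incl_eq_pow e
    have hpow : ∀ k : ℕ, A (e ^ k) x = x := by
      intro k
      induction k with
      | zero => rw [pow_zero, map_one]; rfl
      | succ k ih =>
        rw [pow_succ, map_mul]
        change A (e ^ k) (A e x) = x
        rw [hx, ih]
    have h1 := hpow (Nat.card Q)
    rw [← hl, hAl, add_eq_right] at h1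
    rw [← hl, hj (h1.trans (map_zero j).symm), X.incl_zero]
  have hinj : Function.Injective A := by
    rw [injective_iff_map_eq_one]
    intro e he
    exact hfree e 0 (by rw [he]; rfl)
  -- Further elements of `E` may act as translations when `ρ` is not faithful, but only by vectors
  -- in `|Q|⁻¹ L`.
  have htrans : ∀ v ∈ translationLattice A.range, (Nat.card Q) • v ∈ LinearMap.range j := by
    rintro v ⟨e, he⟩
    obtain ⟨l, hl⟩ := X.exists_incl_eq_pow e
    refine ⟨l, ?_⟩
    have hpow : ∀ k : ℕ, A (e ^ k) 0 = k • v := by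
      intro k
      induction k with
      | zero => rw [pow_zero, map_one, zero_smul]; rfl
      | succ k ih =>
        rw [pow_succ', map_mul]
        change A e (A (e ^ k) 0) = _
        rw [ih, he, succ_nsmul']
        rfl
    rw [← hpow, ← hl, hAl, add_zero]
  refine ⟨d, A.range, A.ofInjective hinj, ?_, ⟨?_, ?_, ?_, ?_⟩, ?_⟩
  · have h1 := Φ.finrank_eq
    rw [Module.finrank_baseChange] at h1
    rw [h1, finrank_real_of_complex, finrank_euclideanSpace_fin]
  · let F : translationLattice A.range → Submodule.span ℤ (Set.range b) :=
      fun v => ⟨Nat.card Q • v.1, hrange ▸ htrans v.1 v.2⟩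
    have hF : Continuous F := by
      refine Continuous.subtype_mk ?_ _
      exact continuous_subtype_val.const_smul _
    refine DiscreteTopology.of_continuous_injective hF fun v w h => Subtype.ext ?_
    have h1 : Nat.card Q • v.1 = Nat.card Q • w.1 := congrArg Subtype.val h
    rw [← Nat.cast_smul_eq_nsmul ℝ, ← Nat.cast_smul_eq_nsmul ℝ] at h1
    exact smul_right_injective W (Nat.cast_ne_zero.2 Nat.card_pos.ne') h1
  · rw [eq_top_iff, ← b.span_eq]
    refine Submodule.span_mono ?_
    rintro _ ⟨i, rfl⟩
    refine ⟨X.incl (Module.Free.chooseBasis ℤ L i), ?_⟩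
    ext1 x
    rw [hAl, ← hb]
    rfl
  · refine Set.Finite.subset (Set.finite_range U) ?_
    rintro _ ⟨_, ⟨e, rfl⟩, rfl⟩
    exact ⟨X.proj e, (hlin e).symm⟩
  · rintro _ ⟨e, rfl⟩ x hx
    rw [hfree e x hx, map_one]
  · intro e
    change linearPart d (A e) = 1 ↔ _
    rw [hlin]
    constructor
    · intro h
      ext l
      apply hj
      rw [hjU, h]
      rfl
    · intro h
      ext1 x
      obtain ⟨v, rfl⟩ := Φ.surjective x
      rw [← hΦ, Representation.extendScalars_apply, h]
      change Φ ((LinearMap.id).baseChange ℝ v) = Φ v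
      rw [LinearMap.baseChange_id]
      rfl

end LatticeExtension

/-! ### The extension defined by a flat Kähler group -/

section FlatKahler

variable {n : ℕ} (Γ : Subgroup (UnitaryAffineGroup n))

theorem linearPart_apply (γ : UnitaryAffineGroup n) (x : EuclideanSpace ℂ (Fin n)) :
    linearPart n γ x = γ x - γ 0 := by
  have h := γ.map_vadd 0 x
  rw [vadd_eq_add, add_zero, vadd_eq_add] at h
  rw [h, add_sub_cancel_right]
  rfl

theorem linearPart_constVAdd (v : EuclideanSpace ℂ (Fin n)) :
    linearPart n (AffineIsometryEquiv.constVAdd ℂ (EuclideanSpace ℂ (Fin n)) v) = 1 := by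
  ext1 x
  rw [linearPart_apply]
  change v + x - (v + 0) = x
  rw [add_zero, add_sub_cancel_left]

theorem conj_constVAdd (γ : UnitaryAffineGroup n) (v : EuclideanSpace ℂ (Fin n)) :
    γ * AffineIsometryEquiv.constVAdd ℂ (EuclideanSpace ℂ (Fin n)) v * γ⁻¹ =
      AffineIsometryEquiv.constVAdd ℂ (EuclideanSpace ℂ (Fin n)) (linearPart n γ v) := by
  rw [mul_inv_eq_iff_eq_mul]
  ext1 x
  exact γ.map_vadd x v

/-- The translation lattice of `Γ` as a `ℤ`-submodule of `ℂⁿ`. -/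
abbrev translationModule : Submodule ℤ (EuclideanSpace ℂ (Fin n)) :=
  AddSubgroup.toIntSubmodule (translationLattice Γ)

/-- The action of the holonomy group on the translation lattice. -/
noncomputable def holonomyRepresentation :
    Representation ℤ (holonomyGroup Γ) (translationModule Γ) where
  toFun q := (q.1.toLinearEquiv.toLinearMap.restrictScalars ℤ).restrict fun v hv => by
    obtain ⟨γ, hγ, hq⟩ := q.2
    change AffineIsometryEquiv.constVAdd ℂ (EuclideanSpace ℂ (Fin n)) (q.1 v) ∈ Γ
    rw [← hq, ← conj_constVAdd]
    exact Γ.mul_mem (Γ.mul_mem hγ hv) (Γ.inv_mem hγ)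
  map_one' := rfl
  map_mul' _ _ := rfl

/-- `Γ` as an extension of its holonomy group by its translation lattice. -/
noncomputable def translationExtension : LatticeExtension Γ (holonomyRepresentation Γ) where
  incl v := ⟨AffineIsometryEquiv.constVAdd ℂ (EuclideanSpace ℂ (Fin n)) v, v.2⟩
  proj := (linearPart n).subgroupMap Γ
  incl_add v w := by
    ext x
    exact congrFun (congrArg _ (add_assoc (v : EuclideanSpace ℂ (Fin n)) w x)) _
  incl_injective v w h := by
    have h1 := congrArg (fun γ : Γ => (γ : UnitaryAffineGroup n) 0) h
    change v.1 + 0 = w.1 + 0 at h1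
    rw [add_zero, add_zero] at h1
    exact Subtype.ext h1
  proj_surjective := (linearPart n).subgroupMap_surjective Γ
  proj_eq_one_iff γ := by
    constructor
    · intro h
      have h1 : linearPart n γ = 1 := congrArg Subtype.val h
      have h2 : AffineIsometryEquiv.constVAdd ℂ (EuclideanSpace ℂ (Fin n)) (γ.1 0) = γ := by
        ext1 x
        have h3 := linearPart_apply γ.1 x
        rw [h1] at h3
        exact (eq_sub_iff_add_eq'.1 h3)
      exact ⟨⟨γ.1 0, by
        change AffineIsometryEquiv.constVAdd ℂ (EuclideanSpace ℂ (Fin n)) (γ.1 0) ∈ Γ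
        rw [h2]
        exact γ.2⟩, Subtype.ext h2⟩
    · rintro ⟨v, rfl⟩
      exact Subtype.ext (linearPart_constVAdd _)
  conj_incl γ v := Subtype.ext (conj_constVAdd γ.1 v)

theorem mem_translationSubgroup_iff (γ : Γ) :
    γ ∈ translationSubgroup Γ ↔ ∃ v, (translationExtension Γ).incl v = γ := by
  rw [← LatticeExtension.proj_eq_one_iff]
  exact (Subtype.ext_iff (a1 := (translationExtension Γ).proj γ) (a2 := 1)).symm

variable {Γ}

theorem IsFlatKahlerGroup.holonomyRepresentation_injective (hΓ : IsFlatKahlerGroup Γ) :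
    Function.Injective (holonomyRepresentation Γ) := by
  rw [injective_iff_map_eq_one]
  intro q hq
  refine Subtype.ext (LinearIsometryEquiv.ext fun x => ?_)
  have hx : x ∈ Submodule.span ℝ (translationLattice Γ : Set (EuclideanSpace ℂ (Fin n))) := by
    rw [hΓ.span_eq_top]
    trivial
  induction hx using Submodule.span_induction with
  | mem v hv =>
    have h1 := congrArg Subtype.val (LinearMap.congr_fun hq ⟨v, hv⟩)
    exact h1
  | zero => rw [map_zero, map_zero]
  | add x y _ _ hx hy => rw [map_add, map_add, hx, hy]
  | smul r x _ hx =>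
    rw [← Complex.coe_smul, map_smul, hx, map_smul]

/-- The centroid of a finite orbit is a fixed point, so that elements of finite order are
trivial. -/
theorem IsFlatKahlerGroup.hasNoTorsion (hΓ : IsFlatKahlerGroup Γ) : HasNoTorsion Γ := by
  intro γ k hk h
  have h' : γ.1 ^ k = 1 := congrArg Subtype.val h
  let c : EuclideanSpace ℂ (Fin n) := ∑ i ∈ Finset.range k, (γ.1 ^ i) 0
  have hsucc : ∀ i, (γ.1 ^ (i + 1)) 0 = γ.1 ((γ.1 ^ i) 0) := fun i => by
    rw [pow_succ']
    rfl
  have hlin : linearPart n γ.1 c + k • γ.1 0 = c := by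
    have h1 : ∀ i, linearPart n γ.1 ((γ.1 ^ i) 0) = (γ.1 ^ (i + 1)) 0 - γ.1 0 := fun i => by
      rw [linearPart_apply, hsucc]
    have h2 := (Finset.sum_range_succ (fun i => (γ.1 ^ i) 0) k).symm.trans
      (Finset.sum_range_succ' (fun i => (γ.1 ^ i) 0) k)
    rw [h', pow_zero] at h2
    simp only [c, map_sum, h1, Finset.sum_sub_distrib, Finset.sum_const, Finset.card_range,
      sub_add_cancel]
    exact (add_right_cancel h2).symm
  refine Subtype.ext (hΓ.free γ.1 γ.2 ((k : ℂ)⁻¹ • c) ?_)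
  have h3 := linearPart_apply γ.1 ((k : ℂ)⁻¹ • c)
  rw [map_smul, eq_sub_iff_add_eq] at h3
  rw [← h3]
  nth_rewrite 2 [← hlin]
  rw [smul_add, ← Nat.cast_smul_eq_nsmul ℂ, smul_smul,
    inv_mul_cancel₀ (Nat.cast_ne_zero.2 hk.ne'), one_smul]

theorem IsFlatKahlerGroup.isZLattice (hΓ : IsFlatKahlerGroup Γ) :
    ∃ _ : DiscreteTopology (translationModule Γ), IsZLattice ℝ (translationModule Γ) :=
  have : DiscreteTopology (translationModule Γ) := hΓ.discrete
  ⟨this, ⟨hΓ.span_eq_top⟩⟩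

theorem IsFlatKahlerGroup.module_free (hΓ : IsFlatKahlerGroup Γ) :
    Module.Free ℤ (translationModule Γ) := by
  obtain ⟨_, _⟩ := hΓ.isZLattice
  exact ZLattice.module_free ℝ _

theorem IsFlatKahlerGroup.module_finite (hΓ : IsFlatKahlerGroup Γ) :
    Module.Finite ℤ (translationModule Γ) := by
  obtain ⟨_, _⟩ := hΓ.isZLattice
  exact ZLattice.module_finite ℝ _

theorem IsFlatKahlerGroup.finrank_translationModule (hΓ : IsFlatKahlerGroup Γ) :
    Module.finrank ℤ (translationModule Γ) = 2 * n := by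
  obtain ⟨_, _⟩ := hΓ.isZLattice
  rw [ZLattice.rank ℝ, finrank_real_of_complex, finrank_euclideanSpace_fin]

/-- Multiplication by `i` on `ℂⁿ = ℝ ⊗ L`. -/
theorem IsFlatKahlerGroup.hasComplexStructure (hΓ : IsFlatKahlerGroup Γ) :
    ((holonomyRepresentation Γ).extendScalars ℝ).HasComplexStructure := by
  obtain ⟨_, _⟩ := hΓ.isZLattice
  have := hΓ.module_free
  have := hΓ.module_finite
  let b := Module.Free.chooseBasis ℤ (translationModule Γ)
  let Ψ : ℝ ⊗[ℤ] translationModule Γ ≃ₗ[ℝ] EuclideanSpace ℂ (Fin n) :=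
    (Algebra.TensorProduct.basis ℝ b).equiv (b.ofZLatticeBasis ℝ (translationModule Γ))
      (Equiv.refl _)
  have hΨ : ∀ v : translationModule Γ, Ψ (1 ⊗ₜ v) = v := by
    intro v
    have : Ψ.toLinearMap.restrictScalars ℤ ∘ₗ TensorProduct.mk ℤ ℝ _ 1 =
        (translationModule Γ).subtype := by
      refine b.ext fun i => ?_
      change Ψ (1 ⊗ₜ b i) = b i
      rw [← Algebra.TensorProduct.basis_apply, Module.Basis.equiv_apply]
      exact b.ofZLatticeBasis_apply ℝ _ i
    exact LinearMap.congr_fun this v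
  let σ : Representation ℝ (holonomyGroup Γ) (EuclideanSpace ℂ (Fin n)) :=
    { toFun := fun q => q.1.toLinearEquiv.toLinearMap.restrictScalars ℝ
      map_one' := rfl
      map_mul' := fun _ _ => rfl }
  have hσ : σ.HasComplexStructure := by
    refine ⟨⟨(Complex.I • LinearMap.id : EuclideanSpace ℂ (Fin n) →ₗ[ℂ] _).restrictScalars ℝ,
      fun q => ?_⟩, fun v => ?_⟩
    · ext1 v
      exact (map_smul q.1 Complex.I v).symm
    · change Complex.I • Complex.I • v = -v
      rw [smul_smul, Complex.I_mul_I, neg_smul, one_smul]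
  refine hσ.of_equiv (Representation.Equiv.symm (Representation.Equiv.mk Ψ fun q => ?_))
  refine TensorProduct.AlgebraTensorModule.curry_injective (LinearMap.ext_ring ?_)
  refine LinearMap.ext fun v => ?_
  change Ψ (1 ⊗ₜ holonomyRepresentation Γ q v) = q.1 (Ψ (1 ⊗ₜ v))
  rw [hΨ, hΨ]
  rfl

end FlatKahler

/-! ### Comparison of the two Vasquez numbers -/

namespace Representation

variable {G H V : Type*} [Group G] [Group H] [AddCommGroup V] [Module ℝ V]

theorem HasComplexStructure.of_comp {ρ : Representation ℝ G V} (f : H →* G)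
    (hf : Function.Surjective f) (h : HasComplexStructure (V := V) (ρ.comp f)) :
    HasComplexStructure ρ := by
  obtain ⟨J, hJ⟩ := h
  refine ⟨⟨J.toLinearMap, fun g => ?_⟩, hJ⟩
  obtain ⟨x, rfl⟩ := hf g
  exact J.isIntertwining' x

theorem HasComplexStructure.comp {ρ : Representation ℝ G V} (h : HasComplexStructure ρ)
    (f : H →* G) : HasComplexStructure (V := V) (ρ.comp f) := by
  obtain ⟨J, hJ⟩ := h
  exact ⟨⟨J.toLinearMap, fun x => J.isIntertwining' (f x)⟩, hJ⟩

/-- The double of a lattice carries the complex structure `(x, y) ↦ (-y, x)`. -/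
theorem hasComplexStructure_extendScalars_prod_self {L : Type*} [AddCommGroup L]
    (ρ : Representation ℤ G L) : HasComplexStructure ((ρ.prod ρ).extendScalars ℝ) := by
  let J : IntertwiningMap (ρ.prod ρ) (ρ.prod ρ) :=
    ⟨(-LinearMap.snd ℤ L L).prod (LinearMap.fst ℤ L L), fun g => by
      refine LinearMap.ext fun v => Prod.ext ?_ rfl
      exact (map_neg (ρ g) v.2).symm⟩
  refine ⟨J.extendScalars ℝ, fun v => ?_⟩
  have h : J.toLinearMap ∘ₗ J.toLinearMap = -LinearMap.id := by
    refine LinearMap.ext fun v => Prod.ext rfl rfl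
  change (J.toLinearMap.baseChange ℝ ∘ₗ J.toLinearMap.baseChange ℝ) v = -v
  rw [← LinearMap.baseChange_comp, h, LinearMap.baseChange_neg, LinearMap.baseChange_id]
  rfl

end Representation

namespace LatticeExtension

variable {E Q L : Type*} [Group E] [Group Q] [AddCommGroup L] {ρ : Representation ℤ Q L}
  (X : LatticeExtension E ρ)

/-- The fibre product `E ×_Q E` is an extension of `Q` by `L × L`. -/
def fiberSquare : LatticeExtension
    ((X.proj.comp (MonoidHom.fst E E)).eqLocus (X.proj.comp (MonoidHom.snd E E)))
    (ρ.prod ρ) where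
  incl l := ⟨(X.incl l.1, X.incl l.2), (X.proj_incl l.1).trans (X.proj_incl l.2).symm⟩
  proj := (X.proj.comp (MonoidHom.fst E E)).comp (Subgroup.subtype _)
  incl_add a b := Subtype.ext (Prod.ext (X.incl_add a.1 b.1) (X.incl_add a.2 b.2))
  incl_injective a b h := by
    have h1 := congrArg Subtype.val h
    exact Prod.ext (X.incl_injective (congrArg Prod.fst h1))
      (X.incl_injective (congrArg Prod.snd h1))
  proj_surjective q := by
    obtain ⟨e, rfl⟩ := X.proj_surjective q
    exact ⟨⟨(e, e), rfl⟩, rfl⟩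
  proj_eq_one_iff e := by
    constructor
    · intro h
      have h2 : X.proj e.1.1 = X.proj e.1.2 := e.2
      have h1 : X.proj e.1.1 = 1 := h
      obtain ⟨l, hl⟩ := (X.proj_eq_one_iff _).1 h1
      obtain ⟨m, hm⟩ := (X.proj_eq_one_iff _).1 (h2.symm.trans h1)
      exact ⟨(l, m), Subtype.ext (Prod.ext hl hm)⟩
    · rintro ⟨l, rfl⟩
      exact X.proj_incl l.1
  conj_incl e l := by
    have h2 : X.proj e.1.1 = X.proj e.1.2 := e.2
    refine Subtype.ext (Prod.ext (X.conj_incl e.1.1 l.1) ((X.conj_incl e.1.2 l.2).trans ?_))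
    rw [← h2]
    rfl

/-- An abelian subgroup of a torsion-free extension of a finite group by a lattice has at most the
rank of the lattice: raise its elements to the power `|Q|`. -/
theorem finrank_le_of_injective (X : LatticeExtension E ρ) [Finite Q] [Module.Finite ℤ L]
    (hE : HasNoTorsion E) {A : Type*} [AddCommGroup A] (ψ : Multiplicative A →* E)
    (hψ : Function.Injective ψ) :
    Module.finrank ℤ A ≤ Module.finrank ℤ L := by
  choose τ hτ using fun a : A => X.exists_incl_eq_pow (ψ (Multiplicative.ofAdd a))
  let T : A →+ L := AddMonoidHom.mk' τ fun a b => by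
    apply X.incl_injective
    rw [X.incl_add, hτ, hτ, hτ, ofAdd_add, map_mul]
    exact ((Commute.all _ _).map ψ).mul_pow _
  have := X.isTorsionFree_of_hasNoTorsion hE
  refine LinearMap.finrank_le_finrank_of_injective (f := T.toIntLinearMap) ?_
  refine (injective_iff_map_eq_zero T).2 fun a ha => ?_
  have h1 : X.incl (τ a) = 1 := (X.incl_eq_one_iff _).2 ha
  rw [hτ] at h1
  exact hψ ((hE _ _ Nat.card_pos h1).trans (map_one ψ).symm)

end LatticeExtension

/-- The quotients of the aspherical Kähler groups with holonomy group `G` by the submodules from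
`exists_submodule_hasComplexStructure` have dimensions `d` satisfying both inequalities. -/
theorem IsVasquezBound.isComplexVasquezBound {G : Type*} [Group G] [Fintype G] {n m : ℕ}
    (hn : IsVasquezBound G n)
    (hm : ∀ d : ℕ, d ≤ n →
      2 * (d : ℝ) ≤ n + ∑ χ ∈ irrReal G, (schurIndexRat χ : ℝ) * (χ 1).re → d ≤ m) :
    IsComplexVasquezBound G m := by
  intro n' Γ hΓ ⟨ε⟩
  have := hΓ.module_free
  have := hΓ.module_finite
  have := hΓ.finite_holonomy
  let X := translationExtension Γ
  obtain ⟨N, hN, _, hle, _, hNtf⟩ :=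
    hn.exists_submodule ⟨ε⟩ hΓ.holonomyRepresentation_injective X hΓ.hasNoTorsion
  let ρ : Representation ℤ G (translationModule Γ) :=
    (holonomyRepresentation Γ).comp ε.symm.toMonoidHom
  obtain ⟨M, hM, hMN, _, hcs, hr, hr'⟩ := ρ.exists_submodule_hasComplexStructure
    (hΓ.hasComplexStructure.comp ε.symm.toMonoidHom) N (fun g => hN _)
  have hM' : ∀ q, M ≤ M.comap (holonomyRepresentation Γ q) := fun q => by
    have h : ε.symm (ε q) = q := ε.symm_apply_apply q
    rw [← h]
    exact hM (ε q)
  have := X.inclSubgroup_normal hM'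
  have hMtf := X.hasNoTorsion_quotient_of_le hMN hNtf
  have hfree : Module.Free ℤ (translationModule Γ ⧸ M) := inferInstance
  obtain ⟨d, Δ, f, hd, hΔ, -⟩ := (X.quotient hM').exists_isFlatKahlerGroup hMtf
    (Representation.HasComplexStructure.of_comp ε.symm.toMonoidHom ε.symm.surjective hcs)
  refine ⟨X.inclSubgroup M, this, ?_, d, hm d ?_ ?_, Δ, hΔ, ⟨f⟩⟩
  · intro γ hγ
    obtain ⟨l, -, rfl⟩ := X.mem_inclSubgroup.1 hγ
    exact (mem_translationSubgroup_iff Γ _).2 ⟨l, rfl⟩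
  · omega
  · rw [hd] at hr'
    push_cast at hr'
    have : (Module.finrank ℤ (translationModule Γ ⧸ N) : ℝ) ≤ n := Nat.cast_le.2 hle
    linarith

/-- For a torsion-free extension `E` of `Q` by `L`, the fibre product `E ×_Q E` is an aspherical
Kähler group, and a quotient of it by a subgroup of `L × L` restricts along the diagonal to a
quotient of `E` by a subgroup of `L`. -/
theorem IsComplexVasquezBound.isVasquezBound {G : Type*} [Group G] [Finite G] {m : ℕ}
    (hm : IsComplexVasquezBound G m) : IsVasquezBound G (2 * m) := by
  refine isVasquezBound_of_extension fun Q _ hQ L _ _ _ ρ hρ E _ X hE => ?_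
  have : Finite Q := Finite.of_equiv G hQ.some.symm
  let Y := X.fiberSquare
  have hY : HasNoTorsion ((X.proj.comp (MonoidHom.fst E E)).eqLocus
      (X.proj.comp (MonoidHom.snd E E))) := by
    intro e k hk he
    have h := congrArg Subtype.val he
    exact Subtype.ext (Prod.ext (hE _ k hk (congrArg Prod.fst h))
      (hE _ k hk (congrArg Prod.snd h)))
  obtain ⟨d₀, Γ, f, -, hΓ, hf⟩ :=
    Y.exists_isFlatKahlerGroup hY ρ.hasComplexStructure_extendScalars_prod_self
  have hf' : ∀ e, linearPart d₀ (f e) = 1 ↔ Y.proj e = 1 := by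
    intro e
    rw [hf]
    constructor
    · intro h
      apply hρ
      rw [map_one]
      ext l
      exact congrArg Prod.fst (LinearMap.congr_fun h (l, 0))
    · intro h
      rw [h, map_one]
  have hhol : Nonempty (holonomyGroup Γ ≃* Q) := by
    let p := ((linearPart d₀).subgroupMap Γ).comp f.toMonoidHom
    have hp : Function.Surjective p :=
      ((linearPart d₀).subgroupMap_surjective Γ).comp f.surjective
    have hker : p.ker = Y.proj.ker := by
      ext e
      rw [MonoidHom.mem_ker, MonoidHom.mem_ker, ← hf']
      exact Subtype.ext_iff
    exact ⟨(QuotientGroup.quotientKerEquivOfSurjective p hp).symm.trans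
      ((QuotientGroup.quotientMulEquivOfEq hker).trans
        (QuotientGroup.quotientKerEquivOfSurjective Y.proj Y.proj_surjective))⟩
  obtain ⟨M, _, hM, d, hd, Δ, hΔ, ⟨g⟩⟩ := hm d₀ Γ hΓ ⟨hhol.some.trans hQ.some⟩
  -- `φ` restricts the quotient map of the fibre product to the diagonal; its kernel is `N`.
  let diag : E →* (X.proj.comp (MonoidHom.fst E E)).eqLocus (X.proj.comp (MonoidHom.snd E E)) :=
    { toFun := fun e => ⟨(e, e), rfl⟩
      map_one' := rfl
      map_mul' := fun _ _ => rfl }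
  let φ : E →* Δ := g.toMonoidHom.comp ((QuotientGroup.mk' M).comp (f.toMonoidHom.comp diag))
  have hφ : ∀ e, φ e = 1 ↔ f (diag e) ∈ M := fun e => by
    rw [← QuotientGroup.eq_one_iff, ← EmbeddingLike.map_eq_one_iff (f := g)]
    rfl
  let N : Submodule ℤ L := AddSubgroup.toIntSubmodule
    (Subgroup.toAddSubgroup' (φ.comp X.inclHom).ker)
  have hNmem : ∀ l, l ∈ N ↔ φ (X.incl l) = 1 := fun _ => Iff.rfl
  have hN : ∀ q, N ≤ N.comap (ρ q) := by
    intro q l hl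
    obtain ⟨e, rfl⟩ := X.proj_surjective q
    rw [Submodule.mem_comap, hNmem, ← X.conj_incl, map_mul, map_mul, (hNmem l).1 hl, mul_one,
      map_inv, mul_inv_cancel]
  have hmem : ∀ e, e ∈ X.inclSubgroup N ↔ φ e = 1 := by
    intro e
    rw [X.mem_inclSubgroup]
    constructor
    · rintro ⟨l, hl, rfl⟩
      exact hl
    · intro he
      have h1 : linearPart d₀ (f (diag e)) = 1 := hM ((hφ e).1 he)
      obtain ⟨l, rfl⟩ := (X.proj_eq_one_iff e).1 ((hf' _).1 h1)
      exact ⟨l, he, rfl⟩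
  have hnormal := X.inclSubgroup_normal hN
  let ψ : E ⧸ X.inclSubgroup N →* Δ :=
    QuotientGroup.lift (X.inclSubgroup N) φ fun e he => (hmem e).1 he
  have hψ : Function.Injective ψ := by
    rw [injective_iff_map_eq_one]
    intro e he
    obtain ⟨e, rfl⟩ := QuotientGroup.mk_surjective e
    exact (QuotientGroup.eq_one_iff e).2 ((hmem e).2 he)
  refine ⟨N, hN, hnormal, ?_, hΔ.hasNoTorsion.of_injective ψ hψ⟩
  have := hΔ.module_finite
  have := hΔ.finite_holonomy
  have hrank := (translationExtension Δ).finrank_le_of_injective hΔ.hasNoTorsion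
    (ψ.comp (X.quotient hN).inclHom) (hψ.comp (X.quotient hN).incl_injective)
  rw [hΔ.finrank_translationModule] at hrank
  omega

theorem sum_schurIndexRat_nonneg (G : Type*) [Group G] [Fintype G] :
    0 ≤ ∑ χ ∈ irrReal G, (schurIndexRat χ : ℝ) * (χ 1).re := by
  refine Finset.sum_nonneg fun χ hχ => mul_nonneg (Nat.cast_nonneg _) ?_
  rw [irrReal, Set.Finite.mem_toFinset] at hχ
  obtain ⟨⟨d, ρ, -, rfl⟩, -⟩ := hχ
  rw [Representation.char_one, Complex.natCast_re]
  exact Nat.cast_nonneg _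

theorem mainTheorem4 {G : Type*} [Group G] [Fintype G] :
    -- both numbers are well defined
    {n : ℕ | IsVasquezBound G n}.Nonempty ∧ {m : ℕ | IsComplexVasquezBound G m}.Nonempty ∧
    (vasquezNumber G : ℝ) / 2 ≤ (complexVasquezNumber G : ℝ) ∧
    complexVasquezNumber G ≤ vasquezNumber G ∧
    (complexVasquezNumber G : ℝ) ≤
      1 / 2 * ((vasquezNumber G : ℝ) +
        ∑ χ ∈ irrReal G, (schurIndexRat χ : ℝ) * (χ 1).re) := by
  have h₁ : {n : ℕ | IsVasquezBound G n}.Nonempty := ⟨_, isVasquezBound_card_sq G⟩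
  have hn : IsVasquezBound G (vasquezNumber G) := Nat.sInf_mem h₁
  have h₂ : IsComplexVasquezBound G (vasquezNumber G) :=
    hn.isComplexVasquezBound fun d hd _ => hd
  have h₃ : {m : ℕ | IsComplexVasquezBound G m}.Nonempty := ⟨_, h₂⟩
  have hm : IsComplexVasquezBound G (complexVasquezNumber G) := Nat.sInf_mem h₃
  refine ⟨h₁, h₃, ?_, Nat.sInf_le h₂, ?_⟩
  · have h : vasquezNumber G ≤ 2 * complexVasquezNumber G := Nat.sInf_le hm.isVasquezBound
    have h' : (vasquezNumber G : ℝ) ≤ 2 * complexVasquezNumber G := by exact_mod_cast h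
    linarith
  · set S := ∑ χ ∈ irrReal G, (schurIndexRat χ : ℝ) * (χ 1).re
    have h0 : 0 ≤ 1 / 2 * ((vasquezNumber G : ℝ) + S) :=
      mul_nonneg (by norm_num) (add_nonneg (Nat.cast_nonneg _) (sum_schurIndexRat_nonneg G))
    have h : complexVasquezNumber G ≤ ⌊1 / 2 * ((vasquezNumber G : ℝ) + S)⌋₊ :=
      Nat.sInf_le (hn.isComplexVasquezBound fun d _ hd => Nat.le_floor (by linarith))
    exact (Nat.le_floor_iff h0).1 h
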